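/- **Setting.** A two-step rule is a map $\mathcal R:\{\text{east},\text{north},\text{west},\text{south}\}^2\to\{0,1\}$; a walk on $\mathbb Z^2$ starting at the origin with unit steps obeys $\mathcal R$ if $\mathcal R(i,j)=1$ whenever a step $i$ is immediately followed by a step $j$ (the first step is arbitrary). Let $\mathbf T=(\mathcal R(i,j))_{i,j}$. The rule is *aperiodic* if $\mathbf T^k$ is entrywise positive for some $k\ge 1$. It is *vertically unbounded* if some walk obeying it has two south steps with no north step between them, and some walk obeying it has two north steps with no south step between them. The generating function of a class of walks is $\sum x^a y^b t^m$ over the walks in the class, where $m$ is the length and $(a,b)$ the endpoint. For a step direction $\theta$: - $B_\theta(t;x,y)$ is the generating function of walks obeying $\mathcal R$ that contain exactly one $\theta$ step, this being their last step, and whose first step may follow a $\theta$ step; - $C_\theta(t;x,y)$ (resp. $D_\theta(t;x,y)$) is the generating function of walks obeying $\mathcal R$ that contain exactly one $\theta$ step, this being their last step, and which do not (resp. do) start with a south step; - $H_\theta(t;x,y)=\sum_m\Theta_m^+(x,y)t^m$ is the generating function of walks obeying $\mathcal R$ that stay in the upper half plane $\{b\ge 0\}$ and end with a $\theta$ step;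 - $H^*(t;x,y)$ is the sum of the $H_\phi(t;x,y)$ over the directions $\phi$ with $\mathcal R(\phi,\text{south})=1$. For $x,y>0$ let $\rho(x,y)$ be the smallest positive root $t$ of $B_\theta(t;x,y)=1$, and let $\mu(x,y)=1/\rho(x,y)$. The vertical drift is $$\delta_{\mathbf y}(x,y)=\frac{B_\theta^{(0,0,1)}(\rho(x,y);x,y)}{\rho(x,y)\,B_\theta^{(1,0,0)}(\rho(x,y);x,y)},$$ where superscripts denote partial derivatives with respect to $(t,x,y)$. **Statement.** Let $\mathcal R$ be an aperiodic, vertically unbounded two-step rule and let $x\in(0,\infty)$. There is exactly one $\tau(x)\in(0,\infty)$ with $\frac{\partial}{\partial y}\rho(x,y)\big|_{y=\tau(x)}=0$. Let $y>\tau(x)$ and write $\rho=\rho(x,y)$, $\mu=\mu(x,y)$. Then $\rho$ exists and does not depend on $\theta$, and the vertical drift $\delta_{\mathbf y}(x,y)$ (computed from any $\theta$) is positive. For every step direction $\theta$, the series $C_\theta(\rho;x,y)$, $D_\theta(\rho;x,y)$ and $H^*(\rho;x,0)$ converge, and the only dominant singularity of $H_\theta(t;x,y)$, as a function of $t$, is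 a simple pole at $t=\rho$: the sum of the power series continues analytically to a disc $|t|<r$ with $r>\rho$, except for a simple pole at $t=\rho$. Near this point $$H_\theta(t;x,y)\underset{t\to\rho}{\sim} c^+(x,y)\,\frac{1}{1-t/\rho},\qquad c^+(x,y)=\frac{C_\theta(\rho;x,y)-D_\theta(\rho;x,y)\,H^*(\rho;x,0)}{\rho\,B_\theta^{(1,0,0)}(\rho;x,y)}>0 .$$ Consequently $$\Theta_m^+(x,y)\sim c^+(x,y)\,\mu^m\qquad\text{as } m\to\infty .$$ -/

import Mathlib

open Filter Topology Asymptotics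

noncomputable section

namespace TwoStep

/-- The four unit steps of the square lattice. -/
inductive Step where
  | east
  | north
  | west
  | south
  deriving DecidableEq

instance : Fintype Step where
  elems := {.east, .north, .west, .south}
  complete := by intro s; cases s <;> decide

/-- Horizontal displacement of a step. -/
def Step.dx : Step → ℤ
  | .east => 1
  | .north => 0
  | .west => -1
  | .south => 0

/-- Vertical displacement of a step. -/
def Step.dy : Step → ℤ
  | .east => 0
  | .north => 1
  | .west => 0
  | .south => -1

/-- A two-step rule: `R i j = true` iff a step `i` may be followed by a step `j`. -/
abbrev Rule := Step → Step → Bool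

/-- The transfer matrix of a rule. -/
def transfer (R : Rule) : Matrix Step Step ℕ :=
  Matrix.of fun i j => if R i j then 1 else 0

/-- Some power of the transfer matrix is entrywise positive. -/
def Aperiodic (R : Rule) : Prop :=
  ∃ k : ℕ, 1 ≤ k ∧ ∀ i j, 0 < (transfer R ^ k) i j

/-- A walk, given by its list of steps, obeys the rule. The first step is unrestricted. -/
def Obeys (R : Rule) (w : List Step) : Prop :=
  w.IsChain fun i j => R i j = true

/-- Between two south steps of a walk there is always a north step. -/
def NorthBound (R : Rule) : Prop :=
  ∀ l : List Step, Obeys R ([Step.south] ++ l ++ [Step.south]) → Step.north ∈ l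

/-- Between two north steps of a walk there is always a south step. -/
def SouthBound (R : Rule) : Prop :=
  ∀ l : List Step, Obeys R ([Step.north] ++ l ++ [Step.north]) → Step.south ∈ l

def VerticallyUnbounded (R : Rule) : Prop :=
  ¬ NorthBound R ∧ ¬ SouthBound R

/-- Horizontal coordinate of the endpoint of a walk from the origin. -/
def xCoord (w : List Step) : ℤ := (w.map Step.dx).sum

/-- Vertical coordinate of the endpoint of a walk from the origin. -/
def yCoord (w : List Step) : ℤ := (w.map Step.dy).sum

open Classical in
/-- Partition function of the walks of length `m` in a class `P`: the sum of `x ^ a * y ^ b`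
over these walks, `(a, b)` being the endpoint. -/
def partitionFn (P : Set (List Step)) (m : ℕ) (x y : ℝ) : ℝ :=
  ∑ w : Fin m → Step with List.ofFn w ∈ P,
    x ^ xCoord (List.ofFn w) * y ^ yCoord (List.ofFn w)

/-- Generating function of a class of walks, `t` marking the length. -/
def gf (P : Set (List Step)) (t x y : ℝ) : ℝ :=
  ∑' m : ℕ, partitionFn P m x y * t ^ m

/-- The generating function of the class converges at the given point. -/
def GFConverges (P : Set (List Step)) (t x y : ℝ) : Prop :=
  Summable fun m : ℕ => partitionFn P m x y * t ^ m

/-- Walks which end with a `θ` step and contain no other `θ` step. -/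
def firstHit (R : Rule) (θ : Step) : Set (List Step) :=
  {w | Obeys R w ∧ w.getLast? = some θ ∧ w.count θ = 1}

/-- The walks counted by `B_θ`: they start with a step that may follow `θ`. -/
def classB (R : Rule) (θ : Step) : Set (List Step) :=
  {w | w ∈ firstHit R θ ∧ ∃ φ, w.head? = some φ ∧ R θ φ = true}

/-- The walks counted by `C_θ`: they do not start with a south step. -/
def classC (R : Rule) (θ : Step) : Set (List Step) :=
  {w | w ∈ firstHit R θ ∧ w.head? ≠ some Step.south}

/-- The walks counted by `D_θ`: they start with a south step. -/
def classD (R : Rule) (θ : Step) : Set (List Step) :=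
  {w | w ∈ firstHit R θ ∧ w.head? = some Step.south}

/-- The walk starts at the origin and stays in the upper half plane. -/
def InHalfPlane (w : List Step) : Prop :=
  ∀ p : List Step, p <+: w → 0 ≤ yCoord p

/-- Walks in the upper half plane which end with a `θ` step, counted by `H_θ`. -/
def classH (R : Rule) (θ : Step) : Set (List Step) :=
  {w | Obeys R w ∧ InHalfPlane w ∧ w.getLast? = some θ}

/-- Walks in the upper half plane whose last step may be followed by a south step,
counted by `H^*`. -/
def classHstar (R : Rule) : Set (List Step) :=
  {w | ∃ θ, w ∈ classH R θ ∧ R θ Step.south = true}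

/-- The positive solutions `t` of `B_θ(t; x, y) = 1`. The value `gf` takes where the series
diverges is `0`, so every element lies in the domain of convergence. -/
def kernelRoots (R : Rule) (θ : Step) (x y : ℝ) : Set ℝ :=
  {t | 0 < t ∧ gf (classB R θ) t x y = 1}

/-- `ρ(x, y)`, the smallest positive root of `B_θ(t; x, y) = 1`. It does not depend on `θ`
(the theorem asserts this); the definition takes `θ = east`. -/
def rho (R : Rule) (x y : ℝ) : ℝ :=
  sInf (kernelRoots R Step.east x y)

/-- `μ(x, y) = 1 / ρ(x, y)`. -/
def mu (R : Rule) (x y : ℝ) : ℝ :=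
  1 / rho R x y

/-- `τ = τ(x)`: the positive value of `y` at which `∂ρ/∂y (x, y) = 0`. -/
def IsTau (R : Rule) (x τ : ℝ) : Prop :=
  0 < τ ∧ HasDerivAt (fun y => rho R x y) 0 τ

/-- The partial derivative `B_θ^{(1,0,0)}(ρ(x, y); x, y)`. -/
def dtB (R : Rule) (θ : Step) (x y : ℝ) : ℝ :=
  deriv (fun t => gf (classB R θ) t x y) (rho R x y)

/-- The partial derivative `B_θ^{(0,0,1)}(ρ(x, y); x, y)`; only the last variable moves. -/
def dyB (R : Rule) (θ : Step) (x y : ℝ) : ℝ :=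
  deriv (fun z => gf (classB R θ) (rho R x y) x z) y

/-- The vertical drift `δ_y(x, y)`, computed from the step direction `θ`. -/
def verticalDrift (R : Rule) (θ : Step) (x y : ℝ) : ℝ :=
  dyB R θ x y / (rho R x y * dtB R θ x y)

/-- The constant `c⁺(x, y)`. All walks in `classHstar` have nonnegative height, so its
generating function at `y = 0` keeps exactly the walks ending on the horizontal axis. -/
def cPlus (R : Rule) (θ : Step) (x y : ℝ) : ℝ :=
  (gf (classC R θ) (rho R x y) x y
      - gf (classD R θ) (rho R x y) x y * gf (classHstar R) (rho R x y) x 0)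
    / (rho R x y * dtB R θ x y)

/-- The power series `∑ a m * t ^ m` has `p` as its only singularity of smallest modulus,
this singularity is a simple pole, and `f(t) ∼ c / (1 - t / p)` as `t → p`, where `f` is the
sum of the series, continued analytically to a disc of radius `r > p` without the point `p`. -/
def HasDominantSimplePole (a : ℕ → ℝ) (p c : ℝ) : Prop :=
  0 < p ∧ ∃ r : ℝ, p < r ∧ ∃ f : ℂ → ℂ,
    (∀ t : ℂ, ‖t‖ < p → HasSum (fun m => (a m : ℂ) * t ^ m) (f t)) ∧
    AnalyticOnNhd ℂ f (Metric.ball 0 r \ {(p : ℂ)}) ∧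
    meromorphicOrderAt f (p : ℂ) = -1 ∧
    f ~[𝓝[≠] (p : ℂ)] fun t => (c : ℂ) * (1 / (1 - t / (p : ℂ)))

end TwoStep

end

open TwoStep

/-! Everything is read off the weighted transfer matrix with entries s(φ)·R(φ,ψ), where s(φ) is the
weight of the step φ. Aperiodicity gives it a Perron eigenvector u > 0 with eigenvalue 1/ρ.
Decomposing by the first step, the series counting walks up to their only θ step solve the
eigenvector equations at t = ρ, except that the row θ is replaced by a boundary value. Deleting the
row θ leaves a strict contraction, so these series converge beyond ρ and equal multiples of u; the
row θ then says B_θ(ρ) = 1 for every θ. As B_θ increases strictly in t, this root is unique and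
independent of θ (`IsPerron.kernelRoots_eq`).

In the coordinates s = log y and p = log t each term of B_θ is a positive multiple of the
exponential of a linear form, so {B_θ ≤ 1} is convex and log ρ is concave in s. Vertical
unboundedness supplies loops of height -1 and +1; they make log ρ tend to -∞ at both ends and make
its maximiser unique. That maximiser is log τ, whence ρ(x,y) < ρ(x,τ) for y > τ. Convexity of B_θ
along s between log τ, where it is below 1, and log y, where it equals 1, makes its y-derivative
positive, hence the drift too.

Decomposing half-plane walks by their last step and pairing with the hitting series gives the kernel
equation H_θ(1 - B_θ) = C_θ - D_θ H^*(t;x,0). The series H^*(t;x,0) does not involve y, so it may be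
bounded by half-plane walks weighted with τ; it is therefore analytic for |t| < ρ(x,τ), a disc
containing ρ(x,y) in its interior. So all terms but H_θ continue past ρ. The equality case of the
triangle inequality, with aperiodicity, shows that 1 - B_θ has no other zero in |t| ≤ ρ, and B_θ' >
0 makes this zero simple (`eq_rho_of_returnSum_eq_one`, `dtB_pos`).

It remains that the numerator is positive at ρ (`numerator_pos`). For θ = south the kernel equation
at y = τ, where H ≥ 0 and B < 1, bounds H^*(ρ;x,0) by a ratio C/D at τ. That ratio increases
strictly from τ to y, and the Perron form of the hitting series carries the inequality to every θ.
Subtracting the pole then gives the coefficient asymptotics. -/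

namespace TwoStep

noncomputable section

/-! ### First-step decomposition of the classes B, C and D. -/

/-- The weight of a single step. -/
def stepWeight {𝕜 : Type*} [Field 𝕜] (x y : 𝕜) (φ : Step) : 𝕜 := x ^ φ.dx * y ^ φ.dy

/-- The entries of the transfer matrix, in an arbitrary semiring. -/
def ruleInd {𝕜 : Type*} [CommSemiring 𝕜] (R : Rule) (φ ψ : Step) : 𝕜 := if R φ ψ then 1 else 0

/-- Total weight of the walks of length `m` that start with `φ`, end with `θ`, and contain no
other `θ` step, for the step weights `s`. -/
def hit {𝕜 : Type*} [CommSemiring 𝕜] (R : Rule) (θ : Step) (s : Step → 𝕜) : ℕ → Step → 𝕜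
  | 0, _ => 0
  | m + 1, φ =>
    s φ * if φ = θ then (if m = 0 then 1 else 0) else ∑ ψ, ruleInd R φ ψ * hit R θ s m ψ

theorem stepWeight_pos {x y : ℝ} (hx : 0 < x) (hy : 0 < y) (φ : Step) : 0 < stepWeight x y φ :=
  mul_pos (zpow_pos hx _) (zpow_pos hy _)

theorem ruleInd_nonneg (R : Rule) (φ ψ : Step) : (0 : ℝ) ≤ ruleInd R φ ψ := by
  unfold ruleInd; split_ifs <;> norm_num

theorem sum_ofFn_succ {M : Type*} [AddCommMonoid M] (g : List Step → M) (m : ℕ) :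
    ∑ w : Fin (m + 1) → Step, g (List.ofFn w)
      = ∑ φ, ∑ w : Fin m → Step, g (φ :: List.ofFn w) := by
  rw [← (Fin.consEquiv (fun _ : Fin (m + 1) => Step)).sum_comp, Fintype.sum_prod_type]
  simp [List.ofFn_succ]

theorem sum_ofFn_succ_last {M : Type*} [AddCommMonoid M] (g : List Step → M) (m : ℕ) :
    ∑ w : Fin (m + 1) → Step, g (List.ofFn w)
      = ∑ φ, ∑ w : Fin m → Step, g (List.ofFn w ++ [φ]) := by
  rw [← (Fin.snocEquiv (fun _ : Fin (m + 1) => Step)).sum_comp, Fintype.sum_prod_type]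
  refine Finset.sum_congr rfl fun φ _ => Finset.sum_congr rfl fun w _ => ?_
  rw [List.ofFn_succ_last]
  simp

open Classical in
theorem partitionFn_eq_sum_ite (P : Set (List Step)) (m : ℕ) (x y : ℝ) :
    partitionFn P m x y = ∑ w : Fin m → Step, if List.ofFn w ∈ P then
      x ^ xCoord (List.ofFn w) * y ^ yCoord (List.ofFn w) else 0 := by
  rw [partitionFn, Finset.sum_filter]

theorem partitionFn_nonneg (P : Set (List Step)) (m : ℕ) {x y : ℝ} (hx : 0 ≤ x) (hy : 0 ≤ y) :
    0 ≤ partitionFn P m x y :=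
  Finset.sum_nonneg fun _ _ => mul_nonneg (zpow_nonneg hx _) (zpow_nonneg hy _)

theorem weight_cons {x y : ℝ} (hx : x ≠ 0) (hy : y ≠ 0) (φ : Step) (l : List Step) :
    x ^ xCoord (φ :: l) * y ^ yCoord (φ :: l)
      = stepWeight x y φ * (x ^ xCoord l * y ^ yCoord l) := by
  simp only [xCoord, yCoord, List.map_cons, List.sum_cons, stepWeight, zpow_add₀ hx, zpow_add₀ hy]
  ring

theorem weight_concat {x y : ℝ} (hx : x ≠ 0) (hy : y ≠ 0) (φ : Step) (l : List Step) :
    x ^ xCoord (l ++ [φ]) * y ^ yCoord (l ++ [φ])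
      = stepWeight x y φ * (x ^ xCoord l * y ^ yCoord l) := by
  simp only [xCoord, yCoord, List.map_append, List.sum_append, List.map_cons, List.sum_cons,
    stepWeight, zpow_add₀ hx, zpow_add₀ hy, List.map_nil, List.sum_nil, zpow_zero]
  ring

theorem cons_mem_firstHit_iff (R : Rule) (θ φ : Step) (l : List Step) :
    φ :: l ∈ firstHit R θ ↔ (l = [] ∧ φ = θ) ∨
      (φ ≠ θ ∧ ∃ ψ, R φ ψ = true ∧ l ∈ firstHit R θ ∧ l.head? = some ψ) := by
  cases l with
  | nil =>
    simp only [firstHit, Set.mem_ofPred_eq, Obeys, List.IsChain.singleton, true_and]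
    by_cases h : φ = θ <;> simp [h]
  | cons ψ l =>
    simp only [firstHit, Set.mem_ofPred_eq, Obeys, List.isChain_cons_cons, List.getLast?_cons_cons,
      List.head?_cons, Option.some.injEq]
    constructor
    · rintro ⟨⟨h1, h2⟩, h3, h4⟩
      have h5 : 0 < (ψ :: l).count θ := List.count_pos_iff.2 (List.mem_of_getLast? h3)
      rw [List.count_cons] at h4
      have h6 : φ ≠ θ := by
        rintro rfl
        simp at h4
        simp [h4] at h5
      refine Or.inr ⟨h6, ψ, h1, ⟨h2, h3, ?_⟩, rfl⟩
      simpa [h6] using h4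
    · rintro (h | ⟨h1, χ, h2, ⟨h3, h4, h5⟩, rfl⟩)
      · simp at h
      · refine ⟨⟨h2, h3⟩, h4, ?_⟩
        rw [List.count_cons, h5]
        simp [h1]

/-- The class of walks ending with their only `θ` step and starting with `φ`. -/
def firstHitFrom (R : Rule) (θ φ : Step) : Set (List Step) :=
  {w | w ∈ firstHit R θ ∧ w.head? = some φ}

theorem cons_mem_firstHitFrom_iff (R : Rule) (θ φ χ : Step) (l : List Step) :
    χ :: l ∈ firstHitFrom R θ φ ↔ χ = φ ∧ ((l = [] ∧ φ = θ) ∨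
      (φ ≠ θ ∧ ∃ ψ, R φ ψ = true ∧ l ∈ firstHitFrom R θ ψ)) := by
  constructor
  · rintro ⟨h1, h2⟩
    obtain rfl : χ = φ := by simpa using h2
    exact ⟨rfl, (cons_mem_firstHit_iff R θ χ l).1 h1⟩
  · rintro ⟨rfl, h⟩
    exact ⟨(cons_mem_firstHit_iff R θ χ l).2 h, rfl⟩

theorem partitionFn_firstHitFrom (R : Rule) (θ : Step) {x y : ℝ} (hx : x ≠ 0) (hy : y ≠ 0)
    (m : ℕ) (φ : Step) :
    partitionFn (firstHitFrom R θ φ) m x y = hit R θ (stepWeight x y) m φ := by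
  classical
  induction m generalizing φ with
  | zero => simp [partitionFn_eq_sum_ite, firstHitFrom, hit]
  | succ m ih =>
    rw [partitionFn_eq_sum_ite, sum_ofFn_succ (fun l => if l ∈ firstHitFrom R θ φ then
      x ^ xCoord l * y ^ yCoord l else 0)]
    rw [Finset.sum_eq_single φ]
    · simp_rw [weight_cons hx hy, hit, ← ih, partitionFn_eq_sum_ite]
      by_cases h : φ = θ
      · subst h
        simp only [cons_mem_firstHitFrom_iff, true_and]
        by_cases hm : m = 0
        · subst hm
          simp [xCoord, yCoord]
        · have : ∀ w : Fin m → Step, List.ofFn w ≠ [] := by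
            intro w h; apply hm; simpa using h
          simp [this, hm]
      · simp only [h, if_false, Finset.mul_sum]
        rw [Finset.sum_comm]
        refine Finset.sum_congr rfl fun w _ => ?_
        simp only [cons_mem_firstHitFrom_iff, true_and]
        by_cases hw : ∃ ψ, R φ ψ = true ∧ List.ofFn w ∈ firstHitFrom R θ ψ
        · have hw' := hw
          obtain ⟨ψ, h1, h2⟩ := hw
          rw [Finset.sum_eq_single ψ]
          · rw [if_pos, if_pos h2]
            · simp [ruleInd, h1]
            · exact Or.inr ⟨h, hw'⟩
          · intro χ _ hχ
            rw [if_neg]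
            · simp
            · intro h3
              exact hχ (Option.some.inj (h3.2.symm.trans h2.2))
          · simp
        · rw [if_neg]
          · symm
            refine Finset.sum_eq_zero fun ψ _ => ?_
            by_cases h1 : R φ ψ = true
            · rw [if_neg]
              · simp
              · intro h2
                exact hw ⟨ψ, h1, h2⟩
            · simp [ruleInd, h1]
          · rintro (h1 | h1)
            · exact h h1.2
            · exact hw h1.2
    · intro ψ _ hψ
      refine Finset.sum_eq_zero fun w _ => if_neg ?_
      rintro ⟨-, h⟩
      simp at h
      exact hψ h
    · simp

/-- The condition `hQ` makes the union disjoint, so weights add. The index is the first step for B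
and C and the last step for H^*. -/
theorem partitionFn_eq_sum_of_iff {ι : Type*} [Fintype ι] {P : Set (List Step)}
    {Q : ι → Set (List Step)} {c : ι → Prop} [DecidablePred c]
    (hP : ∀ w, w ∈ P ↔ ∃ i, c i ∧ w ∈ Q i) (hQ : ∀ w i j, w ∈ Q i → w ∈ Q j → i = j)
    (m : ℕ) (x y : ℝ) :
    partitionFn P m x y = ∑ i, (if c i then 1 else 0) * partitionFn (Q i) m x y := by
  classical
  simp_rw [partitionFn_eq_sum_ite, Finset.mul_sum]
  rw [Finset.sum_comm]
  refine Finset.sum_congr rfl fun w _ => ?_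
  by_cases hw : List.ofFn w ∈ P
  · rw [if_pos hw]
    obtain ⟨i, h1, h2⟩ := (hP _).1 hw
    rw [Finset.sum_eq_single i]
    · simp [h1, h2]
    · intro j _ hj
      rw [if_neg fun h => hj (hQ _ _ _ h h2), mul_zero]
    · simp
  · rw [if_neg hw]
    symm
    refine Finset.sum_eq_zero fun i _ => ?_
    by_cases h1 : c i
    · rw [if_neg fun h => hw ((hP _).2 ⟨i, h1, h⟩), mul_zero]
    · simp [h1]

theorem head_unique_firstHitFrom (R : Rule) (θ : Step) (w : List Step) (φ ψ : Step)
    (h1 : w ∈ firstHitFrom R θ φ) (h2 : w ∈ firstHitFrom R θ ψ) : φ = ψ :=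
  Option.some.inj (h1.2.symm.trans h2.2)

theorem partitionFn_classB (R : Rule) (θ : Step) {x y : ℝ} (hx : x ≠ 0) (hy : y ≠ 0) (m : ℕ) :
    partitionFn (classB R θ) m x y
      = ∑ φ, ruleInd R θ φ * hit R θ (stepWeight x y) m φ := by
  rw [partitionFn_eq_sum_of_iff (Q := firstHitFrom R θ) (c := fun φ => R θ φ = true) _
    (head_unique_firstHitFrom R θ)]
  · simp_rw [partitionFn_firstHitFrom R θ hx hy, ruleInd]
  · intro w
    simp only [classB, firstHitFrom, Set.mem_ofPred_eq]
    tauto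

theorem partitionFn_classC (R : Rule) (θ : Step) {x y : ℝ} (hx : x ≠ 0) (hy : y ≠ 0) (m : ℕ) :
    partitionFn (classC R θ) m x y
      = ∑ φ, (if φ ≠ Step.south then 1 else 0) * hit R θ (stepWeight x y) m φ := by
  rw [partitionFn_eq_sum_of_iff (Q := firstHitFrom R θ) (c := fun φ => φ ≠ Step.south) _
    (head_unique_firstHitFrom R θ)]
  · simp_rw [partitionFn_firstHitFrom R θ hx hy]
  · intro w
    simp only [classC, firstHitFrom, Set.mem_ofPred_eq]
    constructor
    · rintro ⟨h1, h2⟩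
      cases w with
      | nil => simp [firstHit] at h1
      | cons φ l => exact ⟨φ, fun h => h2 (by simp [h]), h1, rfl⟩
    · rintro ⟨φ, h1, h2, h3⟩
      exact ⟨h2, by rw [h3]; simpa using h1⟩

theorem partitionFn_classD (R : Rule) (θ : Step) {x y : ℝ} (hx : x ≠ 0) (hy : y ≠ 0) (m : ℕ) :
    partitionFn (classD R θ) m x y = hit R θ (stepWeight x y) m Step.south :=
  partitionFn_firstHitFrom R θ hx hy m Step.south

/-! ### Last-step decomposition of half-plane walks. -/

theorem inHalfPlane_concat (w : List Step) (θ : Step) :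
    InHalfPlane (w ++ [θ]) ↔ InHalfPlane w ∧ 0 ≤ yCoord w + θ.dy := by
  have : yCoord (w ++ [θ]) = yCoord w + θ.dy := by simp [yCoord]
  rw [← this]
  simp only [InHalfPlane, List.prefix_concat_iff]
  constructor
  · intro h
    exact ⟨fun p hp => h p (Or.inr hp), h _ (Or.inl rfl)⟩
  · rintro ⟨h1, h2⟩ p (rfl | hp)
    · exact h2
    · exact h1 p hp

theorem concat_mem_classH_iff (R : Rule) (θ φ : Step) (w : List Step) :
    w ++ [φ] ∈ classH R θ ↔ φ = θ ∧ ((w = [] ∧ 0 ≤ θ.dy) ∨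
      (∃ ψ, R ψ θ = true ∧ w ∈ classH R ψ ∧ 0 ≤ yCoord w + θ.dy)) := by
  simp only [classH, Set.mem_ofPred_eq, inHalfPlane_concat, List.getLast?_concat, Option.some.injEq]
  by_cases h : φ = θ
  · subst h
    simp only [and_true, true_and]
    rcases List.eq_nil_or_concat w with rfl | ⟨l, ψ, rfl⟩
    · simp [Obeys, InHalfPlane, yCoord]
    · simp only [List.concat_eq_append, Obeys, List.getLast?_concat, Option.some.injEq]
      rw [List.isChain_append (l₁ := l ++ [ψ])]
      simp
      tauto
  · simp [h]

theorem yCoord_nonneg_of_mem_classH {R : Rule} {θ : Step} {w : List Step} (h : w ∈ classH R θ) :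
    0 ≤ yCoord w := h.2.1 w (List.prefix_refl w)

theorem last_unique_classH (R : Rule) (w : List Step) (φ ψ : Step)
    (h1 : w ∈ classH R φ) (h2 : w ∈ classH R ψ) : φ = ψ :=
  Option.some.inj (h1.2.2.symm.trans h2.2.2)

theorem partitionFn_classH_zero (R : Rule) (θ : Step) (x y : ℝ) :
    partitionFn (classH R θ) 0 x y = 0 := by
  classical
  simp [partitionFn_eq_sum_ite, classH]

theorem partitionFn_classHstar (R : Rule) (m : ℕ) (x y : ℝ) :
    partitionFn (classHstar R) m x y
      = ∑ φ, ruleInd R φ Step.south * partitionFn (classH R φ) m x y := by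
  rw [partitionFn_eq_sum_of_iff (Q := classH R) (c := fun φ => R φ Step.south = true) _
    (last_unique_classH R)]
  · simp_rw [ruleInd]
  · intro w
    simp only [classHstar, Set.mem_ofPred_eq]
    tauto

-- The half-plane condition constrains prefixes, so it is the last step that can be split off. The
-- isolated term is the walk of length one, whose prefix is empty and has no last step.
open Classical in
theorem partitionFn_classH_succ_eq_sum (R : Rule) (θ : Step) {x y : ℝ} (hx : x ≠ 0) (hy : y ≠ 0)
    (m : ℕ) :
    partitionFn (classH R θ) (m + 1) x y = stepWeight x y θ *
      ((if m = 0 ∧ 0 ≤ θ.dy then 1 else 0) + ∑ φ, ruleInd R φ θ *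
        ∑ w : Fin m → Step, if List.ofFn w ∈ classH R φ ∧ 0 ≤ yCoord (List.ofFn w) + θ.dy then
          x ^ xCoord (List.ofFn w) * y ^ yCoord (List.ofFn w) else 0) := by
  rw [partitionFn_eq_sum_ite, sum_ofFn_succ_last (fun l => if l ∈ classH R θ then
      x ^ xCoord l * y ^ yCoord l else 0)]
  rw [Finset.sum_eq_single θ]
  · simp_rw [weight_concat hx hy, concat_mem_classH_iff, true_and, Finset.mul_sum]
    rw [Finset.sum_comm]
    rcases Nat.eq_zero_or_pos m with rfl | hm
    · simp [classH, xCoord, yCoord]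
    · have : ∀ w : Fin m → Step, List.ofFn w ≠ [] := by
        intro w h; apply hm.ne'; simpa using h
      simp only [this, false_and, false_or, hm.ne', if_false, zero_add, Finset.mul_sum]
      refine Finset.sum_congr rfl fun w _ => ?_
      by_cases hw : ∃ ψ, R ψ θ = true ∧ List.ofFn w ∈ classH R ψ ∧
          0 ≤ yCoord (List.ofFn w) + θ.dy
      · rw [if_pos hw]
        obtain ⟨ψ, h1, h2⟩ := hw
        rw [Finset.sum_eq_single ψ]
        · simp [h2, ruleInd, h1]
        · intro χ _ hχ
          rw [if_neg]
          · simp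
          · rintro ⟨h3, -⟩
            exact hχ (last_unique_classH R _ _ _ h3 h2.1)
        · simp
      · rw [if_neg hw]
        symm
        refine Finset.sum_eq_zero fun ψ _ => ?_
        by_cases h1 : R ψ θ = true
        · rw [if_neg fun h2 => hw ⟨ψ, h1, h2⟩]
          simp
        · simp [ruleInd, h1]
  · intro φ _ hφ
    refine Finset.sum_eq_zero fun w _ => if_neg ?_
    rw [concat_mem_classH_iff]
    exact fun h => hφ h.1
  · simp

theorem partitionFn_classH_succ (R : Rule) {θ : Step} (hθ : θ ≠ Step.south) {x y : ℝ}
    (hx : x ≠ 0) (hy : y ≠ 0) (m : ℕ) :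
    partitionFn (classH R θ) (m + 1) x y = stepWeight x y θ *
      ((if m = 0 then 1 else 0) + ∑ φ, ruleInd R φ θ * partitionFn (classH R φ) m x y) := by
  classical
  have h0 : 0 ≤ θ.dy := by cases θ <;> simp_all [Step.dy]
  rw [partitionFn_classH_succ_eq_sum R θ hx hy]
  simp only [h0, and_true, partitionFn_eq_sum_ite]
  have (φ : Step) (l : List Step) : l ∈ classH R φ ∧ 0 ≤ yCoord l + θ.dy ↔ l ∈ classH R φ :=
    ⟨fun h => h.1, fun h => ⟨h, add_nonneg (yCoord_nonneg_of_mem_classH h) h0⟩⟩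
  simp only [this]

/-- A south step is forbidden exactly from the axis. Evaluating at `y = 0` keeps these prefixes,
since `0 ^ 0 = 1` and positive heights contribute zero. There is no initial term because a first
south step leaves the half plane. -/
theorem partitionFn_classH_south_succ (R : Rule) {x y : ℝ} (hx : x ≠ 0) (hy : y ≠ 0) (m : ℕ) :
    partitionFn (classH R Step.south) (m + 1) x y = stepWeight x y Step.south *
      (∑ φ, ruleInd R φ Step.south * partitionFn (classH R φ) m x y
        - partitionFn (classHstar R) m x 0) := by
  classical
  rw [partitionFn_classH_succ_eq_sum R _ hx hy, partitionFn_classHstar, ← Finset.sum_sub_distrib]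
  have h0 : ¬ (m = 0 ∧ 0 ≤ Step.south.dy) := by simp [Step.dy]
  rw [if_neg h0, zero_add]
  congr 1
  refine Finset.sum_congr rfl fun φ _ => ?_
  rw [← mul_sub, partitionFn_eq_sum_ite, partitionFn_eq_sum_ite, ← Finset.sum_sub_distrib]
  congr 1
  refine Finset.sum_congr rfl fun w _ => ?_
  by_cases h : List.ofFn w ∈ classH R φ
  · have h1 := yCoord_nonneg_of_mem_classH h
    rcases h1.eq_or_lt with h2 | h2
    · simp [h, ← h2, Step.dy]
    · rw [if_pos ⟨h, by simp only [Step.dy]; lia⟩, if_pos h, if_pos h, zero_zpow _ h2.ne']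
      simp
  · simp [h]

/-! ### Perron eigenvectors of primitive nonnegative matrices. -/

section Perron

variable {ι : Type*} [Fintype ι]

theorem mulVec_pos_of_pos {M : Matrix ι ι ℝ} (hM : ∀ i j, 0 < M i j) {v : ι → ℝ}
    (hv : ∀ i, 0 ≤ v i) {j : ι} (hj : v j ≠ 0) (i : ι) : 0 < (M.mulVec v) i := by
  rw [Matrix.mulVec, dotProduct]
  exact Finset.sum_pos' (fun l _ => mul_nonneg (hM i l).le (hv l))
    ⟨j, Finset.mem_univ j, mul_pos (hM i j) ((hv j).lt_of_ne' hj)⟩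

/-- This bound makes the Collatz–Wielandt maximisation below range over a compact set. -/
theorem le_sum_entries_of_subinvariant {A : Matrix ι ι ℝ} (hA : ∀ i j, 0 ≤ A i j) {lam : ℝ}
    {u : ι → ℝ} (hu : u ∈ stdSimplex ℝ ι) (h : ∀ i, lam * u i ≤ (A.mulVec u) i) :
    lam ≤ ∑ i, ∑ j, A i j := by
  have h1 : ∑ i, lam * u i ≤ ∑ i, (A.mulVec u) i := Finset.sum_le_sum fun i _ => h i
  rw [← Finset.mul_sum, hu.2, mul_one] at h1
  refine h1.trans (Finset.sum_le_sum fun i _ => Finset.sum_le_sum fun j _ => ?_)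
  have h2 : u j ≤ 1 := hu.2 ▸ Finset.single_le_sum (fun i _ => hu.1 i) (Finset.mem_univ j)
  exact mul_le_of_le_one_right (hA i j) h2

/-- The Perron theorem: a nonnegative matrix with a positive power has a positive eigenvector. -/
theorem exists_pos_eigenvector [DecidableEq ι] [Nonempty ι] {A : Matrix ι ι ℝ}
    (hA : ∀ i j, 0 ≤ A i j) {k : ℕ} (hk : k ≠ 0) (hAk : ∀ i j, 0 < (A ^ k) i j) :
    ∃ lam : ℝ, 0 < lam ∧ ∃ u : ι → ℝ, (∀ i, 0 < u i) ∧ A.mulVec u = lam • u := by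
  set M := ∑ i, ∑ j, A i j
  -- Collatz–Wielandt: maximise `lam` over the normalised `u ≥ 0` with `lam • u ≤ A u`.
  let S : Set (ℝ × (ι → ℝ)) :=
    (Set.Icc 0 M ×ˢ stdSimplex ℝ ι) ∩ {p | ∀ i, p.1 * p.2 i ≤ (A.mulVec p.2) i}
  have hS : IsCompact S := by
    refine (isCompact_Icc.prod (isCompact_stdSimplex ℝ ι)).inter_right ?_
    have : {p : ℝ × (ι → ℝ) | ∀ i, p.1 * p.2 i ≤ (A.mulVec p.2) i}
        = ⋂ i, {p : ℝ × (ι → ℝ) | p.1 * p.2 i ≤ (A.mulVec p.2) i} := by ext; simp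
    rw [this]
    refine isClosed_iInter fun i => isClosed_le (by fun_prop) ?_
    simp only [Matrix.mulVec, dotProduct]
    fun_prop
  have hne : S.Nonempty := by
    obtain ⟨i⟩ := ‹Nonempty ι›
    refine ⟨(0, Pi.single i 1), ⟨⟨le_rfl, ?_⟩, single_mem_stdSimplex ℝ i⟩, ?_⟩
    · exact Finset.sum_nonneg fun i _ => Finset.sum_nonneg fun j _ => hA i j
    · intro j
      simp [hA]
  obtain ⟨⟨lam, u⟩, ⟨⟨⟨hlam, -⟩, hu⟩, hsub⟩, hmax⟩ :=
    hS.exists_isMaxOn hne continuous_fst.continuousOn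
  simp only at hlam hu hsub
  replace hsub : ∀ i, lam * u i ≤ (A.mulVec u) i := hsub
  obtain ⟨j₀, hj₀⟩ : ∃ j, u j ≠ 0 := by
    by_contra! h
    have := hu.2
    simp [h] at this
  have hw : ∀ i, 0 < ((A ^ k).mulVec u) i := mulVec_pos_of_pos hAk hu.1 hj₀
  -- If the inequality were strict in some coordinate, applying the positive matrix `A ^ k` would
  -- make it strict in all coordinates for `w = A ^ k u`, and `lam` could be increased.
  have heq : A.mulVec u = lam • u := by
    by_contra hne'
    obtain ⟨j, hj⟩ : ∃ j, (A.mulVec u - lam • u) j ≠ 0 := by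
      by_contra! h
      exact hne' (sub_eq_zero.1 (funext h))
    have hd : ∀ i, 0 < ((A ^ k).mulVec (A.mulVec u - lam • u)) i :=
      mulVec_pos_of_pos hAk (fun i => sub_nonneg.2 (hsub i)) hj
    set w := (A ^ k).mulVec u with hwdef
    have hd' : ∀ i, lam * w i < (A.mulVec w) i := by
      intro i
      have h := hd i
      rw [Matrix.mulVec_sub, Matrix.mulVec_smul, Matrix.mulVec_mulVec, ← pow_succ, pow_succ',
        ← Matrix.mulVec_mulVec, ← hwdef, Pi.sub_apply, Pi.smul_apply, smul_eq_mul, sub_pos] at h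
      exact h
    obtain ⟨i₀, -, hi₀⟩ := Finset.exists_min_image Finset.univ
      (fun i => (A.mulVec w) i / w i) Finset.univ_nonempty
    set nu := (A.mulVec w) i₀ / w i₀
    have h1 : lam < nu := by
      rw [lt_div_iff₀ (hw i₀)]
      exact hd' i₀
    have hs : 0 < ∑ i, w i := Finset.sum_pos (fun i _ => hw i) Finset.univ_nonempty
    let w' := (∑ i, w i)⁻¹ • w
    have hw' : w' ∈ stdSimplex ℝ ι := by
      refine ⟨fun i => mul_nonneg (inv_nonneg.2 hs.le) (hw i).le, ?_⟩
      simp only [w', Pi.smul_apply, smul_eq_mul, ← Finset.mul_sum]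
      exact inv_mul_cancel₀ hs.ne'
    have hsub' : ∀ i, nu * w' i ≤ (A.mulVec w') i := by
      intro i
      simp only [w', Matrix.mulVec_smul, Pi.smul_apply, smul_eq_mul]
      have := (le_div_iff₀ (hw i)).1 (hi₀ i (Finset.mem_univ i))
      calc nu * ((∑ i, w i)⁻¹ * w i) = (∑ i, w i)⁻¹ * (nu * w i) := by ring
        _ ≤ _ := mul_le_mul_of_nonneg_left this (inv_nonneg.2 hs.le)
    have hmem : (nu, w') ∈ S :=
      ⟨⟨⟨hlam.trans h1.le, le_sum_entries_of_subinvariant hA hw' hsub'⟩, hw'⟩, hsub'⟩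
    exact absurd (hmax hmem) (not_le.2 h1)
  have hpow : ∀ n : ℕ, (A ^ n).mulVec u = lam ^ n • u := by
    intro n
    induction n with
    | zero => simp
    | succ n ih => rw [pow_succ, ← Matrix.mulVec_mulVec, heq, Matrix.mulVec_smul, ih, smul_smul,
        pow_succ, mul_comm]
  have hpos : ∀ i, 0 < lam ^ k * u i := by
    intro i
    have := hw i
    rwa [hpow k] at this
  have hlk : 0 < lam ^ k := pos_of_mul_pos_left (hpos j₀) (hu.1 j₀)
  refine ⟨lam, hlam.lt_of_ne' ?_, u, fun i => pos_of_mul_pos_right (hpos i) hlk.le, heq⟩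
  rintro rfl
  simp [hk] at hlk

end Perron

/-! ### Convergence of the hitting series under a contraction. -/

section Hit

variable {𝕜 : Type*}

theorem hit_smul [CommSemiring 𝕜] (R : Rule) (θ : Step) (t : 𝕜) (s : Step → 𝕜) (m : ℕ) (φ : Step) :
    hit R θ (fun χ => t * s χ) m φ = hit R θ s m φ * t ^ m := by
  induction m generalizing φ with
  | zero => simp [hit]
  | succ m ih =>
    simp only [hit, ih]
    by_cases h : φ = θ
    · by_cases hm : m = 0
      · simp [h, hm, mul_comm]
      · simp [h, hm]
    · simp only [h, if_false, ← mul_assoc, ← Finset.sum_mul, pow_succ]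
      ring

theorem map_hit [CommSemiring 𝕜] {𝕜' : Type*} [CommSemiring 𝕜'] (f : 𝕜 →+* 𝕜') (R : Rule)
    (θ : Step) (s : Step → 𝕜) (m : ℕ) (φ : Step) :
    f (hit R θ s m φ) = hit R θ (fun χ => f (s χ)) m φ := by
  induction m generalizing φ with
  | zero => simp [hit]
  | succ m ih =>
    simp only [hit, map_mul, apply_ite f, map_sum, ih, map_one, map_zero, ruleInd]

theorem hit_nonneg (R : Rule) (θ : Step) {s : Step → ℝ} (hs : ∀ φ, 0 ≤ s φ) (m : ℕ) (φ : Step) :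
    0 ≤ hit R θ s m φ := by
  induction m generalizing φ with
  | zero => simp [hit]
  | succ m ih =>
    rw [hit]
    refine mul_nonneg (hs φ) ?_
    split_ifs
    · exact zero_le_one
    · exact le_rfl
    · exact Finset.sum_nonneg fun ψ _ => mul_nonneg (ruleInd_nonneg R φ ψ) (ih ψ)

theorem norm_ruleInd_mul [NormedField 𝕜] (R : Rule) (φ ψ : Step) (z : 𝕜) :
    ‖ruleInd R φ ψ * z‖ = ruleInd R φ ψ * ‖z‖ := by
  unfold ruleInd
  split_ifs <;> simp

/-- The weights `w`, restricted to the steps other than `θ`, contract the positive vector `v`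
by the factor `κ < 1`. -/
structure Contracts (R : Rule) (θ : Step) (w v : Step → ℝ) (κ : ℝ) : Prop where
  κ_pos : 0 < κ
  κ_lt_one : κ < 1
  v_pos : ∀ φ, 0 < v φ
  le : ∀ φ, φ ≠ θ → w φ * ∑ ψ, ruleInd R φ ψ * v ψ ≤ κ * v φ

/-- Each step before the final `θ` costs a factor `κ` in the `v`-weighted sup norm. The constant is
fixed by the one-step walk `θ`, for which the bound is `w θ`. -/
theorem Contracts.norm_hit_le [NormedField 𝕜] {R : Rule} {θ : Step} {w v : Step → ℝ} {κ : ℝ}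
    (hc : Contracts R θ w v κ) {a : Step → 𝕜} (ha : ∀ φ, ‖a φ‖ ≤ w φ) (m : ℕ) (φ : Step) :
    ‖hit R θ a m φ‖ ≤ w θ / (κ * v θ) * κ ^ m * v φ := by
  have hw : ∀ φ, 0 ≤ w φ := fun φ => (norm_nonneg _).trans (ha φ)
  have hC : 0 ≤ w θ / (κ * v θ) := div_nonneg (hw θ) (mul_pos hc.κ_pos (hc.v_pos θ)).le
  have hv := hc.v_pos
  have hκ := hc.κ_pos
  induction m generalizing φ with
  | zero => simpa [hit] using mul_nonneg hC (hv φ).le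
  | succ m ih =>
    rw [hit, norm_mul]
    by_cases h : φ = θ
    · subst h
      by_cases hm : m = 0
      · subst hm
        have : w φ / (κ * v φ) * κ ^ (0 + 1) * v φ = w φ := by
          have := (hv φ).ne'
          field_simp
          ring
        rw [this]
        simpa using ha φ
      · simp only [hm, if_true, if_false, norm_zero, mul_zero]
        have := hv φ
        positivity
    · rw [if_neg h]
      calc ‖a φ‖ * ‖∑ ψ, ruleInd R φ ψ * hit R θ a m ψ‖
          ≤ w φ * ∑ ψ, ruleInd R φ ψ * (w θ / (κ * v θ) * κ ^ m * v ψ) := by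
            refine mul_le_mul (ha φ) ((norm_sum_le _ _).trans (Finset.sum_le_sum fun ψ _ => ?_))
              (norm_nonneg _) (hw φ)
            rw [norm_ruleInd_mul]
            exact mul_le_mul_of_nonneg_left (ih ψ) (ruleInd_nonneg R φ ψ)
        _ = w θ / (κ * v θ) * κ ^ m * (w φ * ∑ ψ, ruleInd R φ ψ * v ψ) := by
            simp only [Finset.mul_sum]
            exact Finset.sum_congr rfl fun ψ _ => by ring
        _ ≤ w θ / (κ * v θ) * κ ^ m * (κ * v φ) :=
            mul_le_mul_of_nonneg_left (hc.le φ h) (mul_nonneg hC (pow_nonneg hκ.le m))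
        _ = _ := by ring

theorem Contracts.summable_bound {R : Rule} {θ : Step} {w v : Step → ℝ} {κ : ℝ}
    (hc : Contracts R θ w v κ) (φ : Step) :
    Summable fun m : ℕ => w θ / (κ * v θ) * κ ^ m * v φ :=
  ((summable_geometric_of_lt_one hc.κ_pos.le hc.κ_lt_one).mul_left _).mul_right _

theorem Contracts.summable_hit [NormedField 𝕜] [CompleteSpace 𝕜] {R : Rule} {θ : Step}
    {w v : Step → ℝ} {κ : ℝ} (hc : Contracts R θ w v κ) {a : Step → 𝕜} (ha : ∀ φ, ‖a φ‖ ≤ w φ)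
    (φ : Step) : Summable fun m => hit R θ a m φ :=
  Summable.of_norm_bounded (hc.summable_bound φ) fun m => hc.norm_hit_le ha m φ

theorem Contracts.mono {R : Rule} {θ : Step} {w v : Step → ℝ} {κ : ℝ}
    (hc : Contracts R θ w v κ) {w' : Step → ℝ} {c : ℝ} (h0 : 0 < c) (hcκ : c * κ < 1)
    (hw' : ∀ φ, w' φ ≤ c * w φ) : Contracts R θ w' v (c * κ) where
  κ_pos := mul_pos h0 hc.κ_pos
  κ_lt_one := hcκ
  v_pos := hc.v_pos
  le φ hφ := by
    have h1 : 0 ≤ ∑ ψ, ruleInd R φ ψ * v ψ :=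
      Finset.sum_nonneg fun ψ _ => mul_nonneg (ruleInd_nonneg R φ ψ) (hc.v_pos ψ).le
    calc w' φ * ∑ ψ, ruleInd R φ ψ * v ψ ≤ c * w φ * ∑ ψ, ruleInd R φ ψ * v ψ :=
          mul_le_mul_of_nonneg_right (hw' φ) h1
      _ = c * (w φ * ∑ ψ, ruleInd R φ ψ * v ψ) := by ring
      _ ≤ c * (κ * v φ) := mul_le_mul_of_nonneg_left (hc.le φ hφ) h0.le
      _ = _ := by ring

/-- The total weight of all walks that start with `φ` and end with their only `θ` step. -/
def hitSum [NormedField 𝕜] (R : Rule) (θ : Step) (a : Step → 𝕜) (φ : Step) : 𝕜 :=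
  ∑' m, hit R θ a m φ

/-- The total weight of all walks that may follow a `θ` step and end with their only `θ` step. -/
def returnSum [NormedField 𝕜] (R : Rule) (θ : Step) (a : Step → 𝕜) : 𝕜 :=
  ∑ φ, ruleInd R θ φ * hitSum R θ a φ

theorem hitSum_eq [NormedField 𝕜] (R : Rule) (θ : Step) {a : Step → 𝕜}
    (h : ∀ φ, Summable fun m => hit R θ a m φ) (φ : Step) :
    hitSum R θ a φ = a φ * if φ = θ then 1 else ∑ ψ, ruleInd R φ ψ * hitSum R θ a ψ := by
  rw [hitSum, (h φ).tsum_eq_zero_add]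
  simp only [hit, zero_add]
  rw [tsum_mul_left]
  congr 1
  by_cases hφ : φ = θ
  · simp [hφ]
  · simp only [hφ, if_false]
    rw [Summable.tsum_finsetSum fun ψ _ => (h ψ).mul_left _]
    exact Finset.sum_congr rfl fun ψ _ => tsum_mul_left

end Hit

/-! ### Perron data of a rule and the values of the hitting series at `ρ`. -/

section PerronRule

/-- `u` is a positive eigenvector, with eigenvalue `1 / ρ`, of the transfer matrix weighted
by `s`. -/
structure IsPerron (R : Rule) (s : Step → ℝ) (ρ : ℝ) (u : Step → ℝ) : Prop where
  ρ_pos : 0 < ρ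
  u_pos : ∀ φ, 0 < u φ
  eq : ∀ φ, u φ = ρ * s φ * ∑ ψ, ruleInd R φ ψ * u ψ

/-- The transfer matrix weighted by `s`. -/
def weightedTransfer (R : Rule) (s : Step → ℝ) : Matrix Step Step ℝ :=
  Matrix.of fun φ ψ => s φ * ruleInd R φ ψ

theorem weightedTransfer_nonneg (R : Rule) {s : Step → ℝ} (hs : ∀ φ, 0 < s φ) (φ ψ : Step) :
    0 ≤ weightedTransfer R s φ ψ :=
  mul_nonneg (hs φ).le (ruleInd_nonneg R φ ψ)

theorem matrix_pow_nonneg {ι : Type*} [Fintype ι] [DecidableEq ι] {A : Matrix ι ι ℝ}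
    (hA : ∀ i j, 0 ≤ A i j) (k : ℕ) (i j : ι) : 0 ≤ (A ^ k) i j := by
  induction k generalizing i j with
  | zero => rw [pow_zero, Matrix.one_apply]; split_ifs <;> norm_num
  | succ k ih =>
    rw [pow_succ, Matrix.mul_apply]
    exact Finset.sum_nonneg fun l _ => mul_nonneg (ih i l) (hA l j)

theorem weightedTransfer_pow_pos (R : Rule) {s : Step → ℝ} (hs : ∀ φ, 0 < s φ) (k : ℕ)
    (i j : Step) (h : 0 < (transfer R ^ k) i j) : 0 < (weightedTransfer R s ^ k) i j := by
  induction k generalizing j with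
  | zero =>
    rw [pow_zero, Matrix.one_apply] at h ⊢
    split_ifs at h ⊢ <;> simp_all
  | succ k ih =>
    rw [pow_succ, Matrix.mul_apply] at h ⊢
    obtain ⟨l, -, hl⟩ := Finset.sum_pos_iff.1 h
    refine Finset.sum_pos' (fun l _ => mul_nonneg
      (matrix_pow_nonneg (weightedTransfer_nonneg R hs) k i l) (weightedTransfer_nonneg R hs l j))
      ⟨l, Finset.mem_univ l, mul_pos (ih l (pos_of_mul_pos_left hl (Nat.zero_le _))) (mul_pos (hs l) ?_)⟩
    have := pos_of_mul_pos_right hl (Nat.zero_le _)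
    simp only [transfer, Matrix.of_apply] at this
    unfold ruleInd
    split_ifs at this ⊢ <;> simp_all

theorem exists_isPerron {R : Rule} (hR : Aperiodic R) {s : Step → ℝ} (hs : ∀ φ, 0 < s φ) :
    ∃ ρ u, IsPerron R s ρ u := by
  obtain ⟨k, hk, hpos⟩ := hR
  have : Nonempty Step := ⟨Step.east⟩
  obtain ⟨lam, hlam, u, hu, h⟩ := exists_pos_eigenvector (weightedTransfer_nonneg R hs)
    (by omega : k ≠ 0) (fun i j => weightedTransfer_pow_pos R hs k i j (hpos i j))
  refine ⟨lam⁻¹, u, inv_pos.2 hlam, hu, fun φ => ?_⟩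
  have h1 := congrFun h φ
  simp only [Matrix.mulVec, dotProduct, weightedTransfer, Matrix.of_apply, Pi.smul_apply,
    smul_eq_mul, mul_assoc, ← Finset.mul_sum] at h1
  rw [mul_assoc, h1, inv_mul_cancel_left₀ hlam.ne']

/-- Removing the row `θ` makes a matrix with a Perron eigenvector a strict contraction. -/
theorem IsPerron.exists_contracts {R : Rule} (hR : Aperiodic R) {s : Step → ℝ}
    (hs : ∀ φ, 0 < s φ) {ρ : ℝ} {u : Step → ℝ} (h : IsPerron R s ρ u) (θ : Step) :
    ∃ v κ, Contracts R θ (fun φ => ρ * s φ) v κ := by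
  obtain ⟨k, -, hpos⟩ := hR
  have hs' : ∀ φ, 0 < ρ * s φ := fun φ => mul_pos h.ρ_pos (hs φ)
  set P := weightedTransfer R (fun φ => ρ * s φ) with hP
  have hP0 : ∀ i j, 0 ≤ P i j := weightedTransfer_nonneg R hs'
  let N : Matrix Step Step ℝ := Matrix.of fun φ ψ => if φ = θ then 0 else P φ ψ
  have hN0 : ∀ i j, 0 ≤ N i j := by
    intro i j
    simp only [N, Matrix.of_apply]
    split_ifs
    exacts [le_rfl, hP0 i j]
  have hNP : ∀ i j, N i j ≤ P i j := by
    intro i j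
    simp only [N, Matrix.of_apply]
    split_ifs
    exacts [hP0 i j, le_rfl]
  have hPu : P.mulVec u = u := by
    ext φ
    simp only [Matrix.mulVec, dotProduct, hP, weightedTransfer, Matrix.of_apply, mul_assoc,
      ← Finset.mul_sum]
    rw [← mul_assoc]
    exact (h.eq φ).symm
  have hPpow : ∀ n : ℕ, (P ^ n).mulVec u = u := by
    intro n
    induction n with
    | zero => simp
    | succ n ih => rw [pow_succ, ← Matrix.mulVec_mulVec, hPu, ih]
  have hmono : ∀ (n : ℕ) (i j : Step), (N ^ n) i j ≤ (P ^ n) i j := by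
    intro n
    induction n with
    | zero => simp
    | succ n ih =>
      intro i j
      rw [pow_succ, pow_succ, Matrix.mul_apply, Matrix.mul_apply]
      exact Finset.sum_le_sum fun l _ => mul_le_mul (ih i l) (hNP l j) (hN0 l j)
        (matrix_pow_nonneg hP0 n i l)
  have hNu : ∀ φ, (N.mulVec u) φ = if φ = θ then 0 else u φ := by
    intro φ
    simp only [N, Matrix.mulVec, dotProduct, Matrix.of_apply]
    split_ifs
    · simp
    · exact congrFun hPu φ
  -- One application of `N` loses mass only at `θ`; the positive matrix `P ^ k`, which dominates `N
  -- ^ k` and fixes `u`, spreads that loss to every coordinate.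
  have hstrict : ∀ φ, ((N ^ (k + 1)).mulVec u) φ < u φ := by
    intro φ
    have h1 : 0 < ((P ^ k).mulVec (u - N.mulVec u)) φ := by
      refine mulVec_pos_of_pos (fun i j => weightedTransfer_pow_pos R hs' k i j (hpos i j))
        (fun i => ?_) (j := θ) ?_ φ
      · rw [Pi.sub_apply, hNu]
        split_ifs
        · simpa using (h.u_pos i).le
        · simp
      · rw [Pi.sub_apply, hNu]
        simpa using (h.u_pos θ).ne'
    rw [Matrix.mulVec_sub, hPpow, Pi.sub_apply, sub_pos] at h1
    refine lt_of_le_of_lt ?_ h1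
    rw [pow_succ, ← Matrix.mulVec_mulVec]
    rw [Matrix.mulVec, Matrix.mulVec, dotProduct, dotProduct]
    refine Finset.sum_le_sum fun j _ => mul_le_mul_of_nonneg_right (hmono k φ j) ?_
    rw [hNu]
    split_ifs
    exacts [le_rfl, (h.u_pos j).le]
  have : Nonempty Step := ⟨θ⟩
  obtain ⟨i₀, -, hi₀⟩ := Finset.exists_max_image Finset.univ
    (fun i => ((N ^ (k + 1)).mulVec u) i / u i) Finset.univ_nonempty
  set q := ((N ^ (k + 1)).mulVec u) i₀ / u i₀
  have hq1 : q < 1 := (div_lt_one (h.u_pos i₀)).2 (hstrict i₀)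
  have hNq : ∀ i, ((N ^ (k + 1)).mulVec u) i ≤ q * u i := fun i =>
    (div_le_iff₀ (h.u_pos i)).1 (hi₀ i (Finset.mem_univ i))
  -- Taking `κ` close to 1, rather than the root of `q` of order `k + 1`, keeps `κ` positive even if
  -- `q = 0`.
  obtain ⟨κ, hκ0, hκ1, hκ⟩ : ∃ κ : ℝ, 0 < κ ∧ κ < 1 ∧ q ≤ κ ^ (k + 1) := by
    have h1 : ∀ᶠ κ : ℝ in 𝓝[<] 1, q < κ ^ (k + 1) := by
      have : Tendsto (fun κ : ℝ => κ ^ (k + 1)) (𝓝[<] 1) (𝓝 1) := by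
        have := ((continuous_pow (M := ℝ) (k + 1)).tendsto 1).mono_left
          (nhdsWithin_le_nhds (s := Set.Iio 1))
        simpa using this
      exact this.eventually (lt_mem_nhds hq1)
    have h2 : ∀ᶠ κ : ℝ in 𝓝[<] 1, κ ∈ Set.Ioo (0 : ℝ) 1 :=
      Ioo_mem_nhdsLT (by norm_num)
    obtain ⟨κ, h3, h4⟩ := (h1.and h2).exists
    exact ⟨κ, h4.1, h4.2, h3.le⟩
  have hvn : ∀ n φ, 0 ≤ ((N ^ n).mulVec u) φ := fun n φ => by
    rw [Matrix.mulVec, dotProduct]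
    exact Finset.sum_nonneg fun j _ => mul_nonneg (matrix_pow_nonneg hN0 _ _ _) (h.u_pos j).le
  -- This averaging turns contraction by `N ^ (k + 1)` into contraction by `N` itself: the sums for
  -- `N v` and `κ v` telescope, leaving only `N ^ (k + 1) u` and `κ ^ (k + 1) u`.
  let v : Step → ℝ := ∑ j ∈ Finset.range (k + 1), κ ^ (k - j) • (N ^ j).mulVec u
  have hNv : N.mulVec v + κ ^ (k + 1) • u = κ • v + (N ^ (k + 1)).mulVec u := by
    have h1 : N.mulVec v = ∑ j ∈ Finset.range (k + 1), κ ^ (k - j) • (N ^ (j + 1)).mulVec u := by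
      simp only [v, Matrix.mulVec_sum, Matrix.mulVec_smul, Matrix.mulVec_mulVec, ← pow_succ']
    have h2 : κ • v = ∑ j ∈ Finset.range (k + 1), κ ^ (k + 1 - j) • (N ^ j).mulVec u := by
      simp only [v, Finset.smul_sum, smul_smul, ← pow_succ']
      refine Finset.sum_congr rfl fun j hj => ?_
      rw [Nat.sub_add_comm (by simpa [Nat.lt_succ_iff] using hj)]
    have h3 := Finset.sum_range_succ (fun j => κ ^ (k + 1 - j) • (N ^ j).mulVec u) (k + 1)
    rw [Finset.sum_range_succ'] at h3
    simp only [Nat.add_sub_add_right, ← h1, ← h2, Nat.sub_zero, pow_zero, Matrix.one_mulVec,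
      Nat.sub_self, one_smul] at h3
    exact h3
  refine ⟨v, κ, hκ0, hκ1, fun φ => ?_, fun φ hφ => ?_⟩
  · simp only [v, Finset.sum_apply, Pi.smul_apply, smul_eq_mul]
    refine Finset.sum_pos' (fun j _ => mul_nonneg (pow_nonneg hκ0.le _) (hvn j φ))
      ⟨0, by simp, ?_⟩
    simpa using mul_pos (pow_pos hκ0 k) (h.u_pos φ)
  · have h1 := congrFun hNv φ
    simp only [Pi.add_apply, Pi.smul_apply, smul_eq_mul] at h1
    have h2 : (N.mulVec v) φ = ρ * s φ * ∑ ψ, ruleInd R φ ψ * v ψ := by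
      simp only [N, Matrix.mulVec, dotProduct, Matrix.of_apply, hφ, if_false, hP, weightedTransfer,
        mul_assoc, ← Finset.mul_sum]
    have h3 := mul_le_mul_of_nonneg_right hκ (h.u_pos φ).le
    have h4 := hNq φ
    linarith

/-- A contraction has no nonzero fixed vector. -/
theorem Contracts.eq_zero_of_fixed {R : Rule} {θ : Step} {w v : Step → ℝ} {κ : ℝ}
    (hc : Contracts R θ w v κ) (hw : ∀ φ, 0 ≤ w φ) {d : Step → ℝ}
    (hd : ∀ φ, d φ = if φ = θ then 0 else w φ * ∑ ψ, ruleInd R φ ψ * d ψ) (φ : Step) :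
    d φ = 0 := by
  have : Nonempty Step := ⟨θ⟩
  -- At a coordinate attaining the `v`-weighted sup norm `M`, the fixed-point equation gives `M ≤ κ
  -- M`, hence `M = 0`.
  obtain ⟨i, -, hi⟩ := Finset.exists_max_image Finset.univ (fun i => |d i| / v i)
    Finset.univ_nonempty
  set M := |d i| / v i
  have hM : ∀ j, |d j| ≤ M * v j := fun j =>
    (div_le_iff₀ (hc.v_pos j)).1 (hi j (Finset.mem_univ j))
  have hM0 : 0 ≤ M := div_nonneg (abs_nonneg _) (hc.v_pos i).le
  have h1 : |d i| ≤ κ * (M * v i) := by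
    rw [hd i]
    split_ifs with h
    · simpa using mul_nonneg hc.κ_pos.le (mul_nonneg hM0 (hc.v_pos i).le)
    · rw [abs_mul, abs_of_nonneg (hw i)]
      calc w i * |∑ ψ, ruleInd R i ψ * d ψ| ≤ w i * ∑ ψ, ruleInd R i ψ * (M * v ψ) := by
            refine mul_le_mul_of_nonneg_left ((Finset.abs_sum_le_sum_abs _ _).trans
              (Finset.sum_le_sum fun ψ _ => ?_)) (hw i)
            rw [abs_mul, abs_of_nonneg (ruleInd_nonneg R i ψ)]
            exact mul_le_mul_of_nonneg_left (hM ψ) (ruleInd_nonneg R i ψ)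
        _ = M * (w i * ∑ ψ, ruleInd R i ψ * v ψ) := by
            simp only [Finset.mul_sum]
            exact Finset.sum_congr rfl fun ψ _ => by ring
        _ ≤ M * (κ * v i) := mul_le_mul_of_nonneg_left (hc.le i h) hM0
        _ = _ := by ring
  have h2 : |d i| = M * v i := (div_mul_cancel₀ _ (hc.v_pos i).ne').symm
  have h3 : M * v i = 0 := by
    have := hc.κ_lt_one
    have h5 : 0 ≤ M * v i := mul_nonneg hM0 (hc.v_pos i).le
    rw [h2] at h1
    nlinarith
  have h4 : M = 0 := (mul_eq_zero.1 h3).resolve_right (hc.v_pos i).ne'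
  have := hM φ
  rw [h4, zero_mul] at this
  exact abs_nonpos_iff.1 this

/-- Both sides satisfy the first-step equations off `θ` and agree at `θ`, so their difference is
fixed by a contraction. -/
theorem IsPerron.hitSum_eq {R : Rule} (hR : Aperiodic R) {s : Step → ℝ} (hs : ∀ φ, 0 < s φ) {ρ : ℝ}
    {u : Step → ℝ} (h : IsPerron R s ρ u) (θ φ : Step) :
    hitSum R θ (fun χ => ρ * s χ) φ = ρ * s θ / u θ * u φ := by
  obtain ⟨v, κ, hc⟩ := h.exists_contracts hR hs θ
  have hs' : ∀ φ, 0 < ρ * s φ := fun φ => mul_pos h.ρ_pos (hs φ)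
  have hsum : ∀ φ, Summable fun m => hit R θ (fun χ => ρ * s χ) m φ :=
    hc.summable_hit fun φ => (Real.norm_of_nonneg (hs' φ).le).le
  have hd := hc.eq_zero_of_fixed (fun φ => (hs' φ).le)
    (d := fun φ => hitSum R θ (fun χ => ρ * s χ) φ - ρ * s θ / u θ * u φ) ?_ φ
  · exact sub_eq_zero.1 hd
  · intro φ
    rw [TwoStep.hitSum_eq R θ hsum φ]
    split_ifs with hφ
    · subst hφ
      rw [div_mul_cancel₀ _ (h.u_pos φ).ne']
      ring
    · simp only [mul_sub, Finset.sum_sub_distrib]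
      rw [h.eq φ]
      simp only [Finset.mul_sum]
      congr 1
      exact Finset.sum_congr rfl fun ψ _ => by ring

/-- This is the row `θ` of the eigenvector equation, the one row that the first-step equations do
not contain. -/
theorem IsPerron.returnSum_eq_one {R : Rule} (hR : Aperiodic R) {s : Step → ℝ} (hs : ∀ φ, 0 < s φ)
    {ρ : ℝ} {u : Step → ℝ} (h : IsPerron R s ρ u) (θ : Step) :
    returnSum R θ (fun χ => ρ * s χ) = 1 := by
  simp only [returnSum, h.hitSum_eq hR hs]
  have h1 := h.eq θ
  have h2 := (h.u_pos θ).ne'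
  have : ∑ φ, ruleInd R θ φ * (ρ * s θ / u θ * u φ)
      = ρ * s θ * (∑ φ, ruleInd R θ φ * u φ) / u θ := by
    rw [Finset.mul_sum, Finset.sum_div]
    exact Finset.sum_congr rfl fun φ _ => by ring
  rw [this, ← h1, div_self h2]

end PerronRule

/-! ### The root of the equation `B_θ = 1`. -/

theorem hasSum_hitSum {𝕜 : Type*} [NormedField 𝕜] [CompleteSpace 𝕜] {R : Rule} {θ : Step}
    {w v : Step → ℝ} {κ : ℝ} (hc : Contracts R θ w v κ) {a : Step → 𝕜} (ha : ∀ φ, ‖a φ‖ ≤ w φ)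
    (φ : Step) : HasSum (fun m => hit R θ a m φ) (hitSum R θ a φ) :=
  (hc.summable_hit ha φ).hasSum

theorem partitionFn_classB_mul_pow (R : Rule) (θ : Step) {x y : ℝ} (hx : 0 < x) (hy : 0 < y)
    (t : ℝ) (m : ℕ) :
    partitionFn (classB R θ) m x y * t ^ m
      = ∑ φ, ruleInd R θ φ * hit R θ (fun χ => t * stepWeight x y χ) m φ := by
  simp only [partitionFn_classB R θ hx.ne' hy.ne', hit_smul, Finset.sum_mul, mul_assoc]

theorem hasSum_classB {R : Rule} {θ : Step} {w v : Step → ℝ} {κ : ℝ} (hc : Contracts R θ w v κ)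
    {x y t : ℝ} (hx : 0 < x) (hy : 0 < y) (hw : ∀ φ, ‖t * stepWeight x y φ‖ ≤ w φ) :
    HasSum (fun m => partitionFn (classB R θ) m x y * t ^ m)
      (returnSum R θ fun φ => t * stepWeight x y φ) := by
  simp only [partitionFn_classB_mul_pow R θ hx hy]
  exact hasSum_sum fun φ _ => (hasSum_hitSum hc hw φ).mul_left _

theorem partitionFn_classB_zero (R : Rule) (θ : Step) {x y : ℝ} (hx : 0 < x) (hy : 0 < y) :
    partitionFn (classB R θ) 0 x y = 0 := by
  simp [partitionFn_classB R θ hx.ne' hy.ne', hit]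

/-- A power series with nonnegative coefficients and no constant term is strictly increasing. -/
theorem tsum_mul_pow_lt {b : ℕ → ℝ} (hb : ∀ m, 0 ≤ b m) (h0 : b 0 = 0) {t₁ t₂ S : ℝ}
    (ht₁ : 0 ≤ t₁) (ht : t₁ < t₂) (hS : 0 < S) (h : HasSum (fun m => b m * t₂ ^ m) S) :
    Summable (fun m => b m * t₁ ^ m) ∧ ∑' m, b m * t₁ ^ m < S := by
  have hle : ∀ m, b m * t₁ ^ m ≤ b m * t₂ ^ m := fun m =>
    mul_le_mul_of_nonneg_left (pow_le_pow_left₀ ht₁ ht.le m) (hb m)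
  have hsum : Summable (fun m => b m * t₁ ^ m) :=
    Summable.of_nonneg_of_le (fun m => mul_nonneg (hb m) (pow_nonneg ht₁ m)) hle h.summable
  refine ⟨hsum, ?_⟩
  obtain ⟨m, hm⟩ : ∃ m, b m ≠ 0 := by
    by_contra! hall
    have : S = 0 := h.unique (by simp [hall])
    exact hS.ne' this
  rw [← h.tsum_eq]
  refine Summable.tsum_lt_tsum (i := m) hle ?_ hsum h.summable
  refine mul_lt_mul_of_pos_left (pow_lt_pow_left₀ ht ht₁ ?_) ((hb m).lt_of_ne' hm)
  rintro rfl
  exact hm h0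

theorem IsPerron.hasSum_classB {R : Rule} (hR : Aperiodic R) {x y : ℝ} (hx : 0 < x) (hy : 0 < y)
    {ρ : ℝ} {u : Step → ℝ} (h : IsPerron R (stepWeight x y) ρ u) (θ : Step) :
    HasSum (fun m => partitionFn (classB R θ) m x y * ρ ^ m) 1 := by
  have hs := stepWeight_pos hx hy
  obtain ⟨v, κ, hc⟩ := h.exists_contracts hR hs θ
  rw [← h.returnSum_eq_one hR hs θ]
  exact TwoStep.hasSum_classB hc hx hy
    fun φ => (Real.norm_of_nonneg (mul_pos h.ρ_pos (hs φ)).le).le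

/-- The series increases strictly where it converges, so the Perron value is the only root. As `ρ`
does not refer to `θ`, this also gives independence of `θ`. -/
theorem IsPerron.kernelRoots_eq {R : Rule} (hR : Aperiodic R) {x y : ℝ} (hx : 0 < x) (hy : 0 < y)
    {ρ : ℝ} {u : Step → ℝ} (h : IsPerron R (stepWeight x y) ρ u) (θ : Step) :
    kernelRoots R θ x y = {ρ} := by
  have hb : ∀ m, 0 ≤ partitionFn (classB R θ) m x y := fun m => partitionFn_nonneg _ m hx.le hy.le
  have hb0 := partitionFn_classB_zero R θ hx hy
  have hsum := h.hasSum_classB hR hx hy θ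
  ext t
  simp only [kernelRoots, Set.mem_ofPred_eq, Set.mem_singleton_iff]
  constructor
  · rintro ⟨ht, h1⟩
    have hst : HasSum (fun m => partitionFn (classB R θ) m x y * t ^ m) 1 := by
      rw [← h1]
      refine Summable.hasSum ?_
      -- A divergent series has `tsum` equal to 0, so the value 1 forces convergence.
      by_contra hns
      rw [gf, tsum_eq_zero_of_not_summable hns] at h1
      exact zero_ne_one h1
    rcases lt_trichotomy t ρ with hlt | heq | hgt
    · have := (tsum_mul_pow_lt hb hb0 ht.le hlt one_pos hsum).2
      rw [hst.tsum_eq] at this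
      exact absurd this (lt_irrefl _)
    · exact heq
    · have := (tsum_mul_pow_lt hb hb0 h.ρ_pos.le hgt one_pos hst).2
      rw [hsum.tsum_eq] at this
      exact absurd this (lt_irrefl _)
  · rintro rfl
    exact ⟨h.ρ_pos, hsum.tsum_eq⟩

theorem exists_isPerron_rho {R : Rule} (hR : Aperiodic R) {x y : ℝ} (hx : 0 < x) (hy : 0 < y) :
    ∃ u, IsPerron R (stepWeight x y) (rho R x y) u := by
  obtain ⟨ρ, u, h⟩ := exists_isPerron hR (stepWeight_pos hx hy)
  refine ⟨u, ?_⟩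
  rwa [rho, h.kernelRoots_eq hR hx hy, csInf_singleton]

theorem rho_pos {R : Rule} (hR : Aperiodic R) {x y : ℝ} (hx : 0 < x) (hy : 0 < y) :
    0 < rho R x y := (exists_isPerron_rho hR hx hy).choose_spec.ρ_pos

theorem hasSum_classB_rho {R : Rule} (hR : Aperiodic R) {x y : ℝ} (hx : 0 < x) (hy : 0 < y)
    (θ : Step) : HasSum (fun m => partitionFn (classB R θ) m x y * rho R x y ^ m) 1 :=
  (exists_isPerron_rho hR hx hy).choose_spec.hasSum_classB hR hx hy θ

theorem isLeast_kernelRoots {R : Rule} (hR : Aperiodic R) {x y : ℝ} (hx : 0 < x) (hy : 0 < y)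
    (θ : Step) : IsLeast (kernelRoots R θ x y) (rho R x y) := by
  obtain ⟨u, hu⟩ := exists_isPerron_rho hR hx hy
  rw [hu.kernelRoots_eq hR hx hy]
  exact isLeast_singleton

/-- Through this lemma and its strict form, upper bounds for `B_θ` become lower bounds for `ρ`, with
no implicit function theorem. -/
theorem le_rho_of_gf_le_one {R : Rule} (hR : Aperiodic R) {x y : ℝ} (hx : 0 < x) (hy : 0 < y)
    {θ : Step} {t : ℝ} (hconv : GFConverges (classB R θ) t x y)
    (h : gf (classB R θ) t x y ≤ 1) : t ≤ rho R x y := by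
  by_contra! hlt
  have hb : ∀ m, 0 ≤ partitionFn (classB R θ) m x y := fun m => partitionFn_nonneg _ m hx.le hy.le
  have hρ := rho_pos hR hx hy
  have hsum := hasSum_classB_rho hR hx hy θ
  have hS : 0 < gf (classB R θ) t x y := by
    refine lt_of_lt_of_le one_pos ?_
    rw [← hsum.tsum_eq]
    exact hsum.summable.tsum_le_tsum
      (fun m => mul_le_mul_of_nonneg_left (pow_le_pow_left₀ hρ.le hlt.le m) (hb m)) hconv
  have := (tsum_mul_pow_lt hb (partitionFn_classB_zero R θ hx hy) hρ.le hlt hS hconv.hasSum).2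
  rw [hsum.tsum_eq] at this
  exact absurd h (not_le.2 this)

theorem lt_rho_of_gf_lt_one {R : Rule} (hR : Aperiodic R) {x y : ℝ} (hx : 0 < x) (hy : 0 < y)
    {θ : Step} {t : ℝ} (hconv : GFConverges (classB R θ) t x y)
    (h : gf (classB R θ) t x y < 1) : t < rho R x y := by
  refine (le_rho_of_gf_le_one hR hx hy hconv h.le).lt_of_ne ?_
  rintro rfl
  rw [gf, (hasSum_classB_rho hR hx hy θ).tsum_eq] at h
  exact lt_irrefl _ h

theorem gf_classB_lt_one {R : Rule} (hR : Aperiodic R) {x y : ℝ} (hx : 0 < x) (hy : 0 < y)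
    (θ : Step) {t : ℝ} (ht0 : 0 ≤ t) (ht : t < rho R x y) :
    GFConverges (classB R θ) t x y ∧ gf (classB R θ) t x y < 1 :=
  tsum_mul_pow_lt (fun m => partitionFn_nonneg _ m hx.le hy.le) (partitionFn_classB_zero R θ hx hy)
    ht0 ht one_pos (hasSum_classB_rho hR hx hy θ)

/-! ### Convexity in logarithmic coordinates -/

theorem walk_term_eq_exp (b : ℤ) (m : ℕ) (s p : ℝ) :
    Real.exp s ^ b * Real.exp p ^ m = Real.exp (b * s + m * p) := by
  rw [← Real.rpow_intCast, ← Real.rpow_natCast, ← Real.exp_mul, ← Real.exp_mul, ← Real.exp_add]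
  ring_nf

open Classical in
theorem partitionFn_mul_exp_pow (P : Set (List Step)) (m : ℕ) (x s p : ℝ) :
    partitionFn P m x (Real.exp s) * Real.exp p ^ m
      = ∑ w : Fin m → Step, if List.ofFn w ∈ P then
          x ^ xCoord (List.ofFn w) * Real.exp (yCoord (List.ofFn w) * s + m * p) else 0 := by
  rw [partitionFn_eq_sum_ite, Finset.sum_mul]
  refine Finset.sum_congr rfl fun w _ => ?_
  split_ifs
  · rw [mul_assoc, walk_term_eq_exp]
  · simp

/-- Each walk contributes a positive multiple of the exponential of a linear form in `(s, p) = (log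
y, log t)`, which is jointly convex. -/
theorem partitionFn_convex (P : Set (List Step)) (m : ℕ) {x : ℝ} (hx : 0 < x) (s₁ s₂ p₁ p₂ : ℝ)
    {a b : ℝ} (ha : 0 ≤ a) (hb : 0 ≤ b) (hab : a + b = 1) :
    partitionFn P m x (Real.exp (a * s₁ + b * s₂)) * Real.exp (a * p₁ + b * p₂) ^ m
      ≤ a * (partitionFn P m x (Real.exp s₁) * Real.exp p₁ ^ m)
        + b * (partitionFn P m x (Real.exp s₂) * Real.exp p₂ ^ m) := by
  classical
  simp only [partitionFn_mul_exp_pow, Finset.mul_sum]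
  rw [← Finset.sum_add_distrib]
  refine Finset.sum_le_sum fun w _ => ?_
  split_ifs
  · set k : ℝ := ((yCoord (List.ofFn w) : ℤ) : ℝ)
    have h := convexOn_exp.2 (Set.mem_univ (k * s₁ + m * p₁)) (Set.mem_univ (k * s₂ + m * p₂))
      ha hb hab
    simp only [smul_eq_mul] at h
    have h2 : k * (a * s₁ + b * s₂) + m * (a * p₁ + b * p₂)
        = a * (k * s₁ + m * p₁) + b * (k * s₂ + m * p₂) := by ring
    rw [h2]
    calc _ ≤ _ := mul_le_mul_of_nonneg_left h (zpow_pos hx _).le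
      _ = _ := by ring
  · simp

theorem partitionFn_strictConvex {P : Set (List Step)} {x : ℝ} (hx : 0 < x) {s₁ s₂ : ℝ} (p : ℝ)
    (hs : s₁ ≠ s₂) {w : List Step} (hw : w ∈ P) (hy : yCoord w ≠ 0) {a b : ℝ} (ha : 0 < a)
    (hb : 0 < b) (hab : a + b = 1) :
    partitionFn P w.length x (Real.exp (a * s₁ + b * s₂)) * Real.exp p ^ w.length
      < a * (partitionFn P w.length x (Real.exp s₁) * Real.exp p ^ w.length)
        + b * (partitionFn P w.length x (Real.exp s₂) * Real.exp p ^ w.length) := by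
  classical
  simp only [partitionFn_mul_exp_pow, Finset.mul_sum]
  rw [← Finset.sum_add_distrib]
  have key : ∀ k : ℝ, k * (a * s₁ + b * s₂) + w.length * p
      = a * (k * s₁ + w.length * p) + b * (k * s₂ + w.length * p) := by
    intro k
    have : b = 1 - a := by linarith
    rw [this]; ring
  refine Finset.sum_lt_sum (fun v _ => ?_) ⟨w.get, Finset.mem_univ _, ?_⟩
  · split_ifs
    · set k : ℝ := ((yCoord (List.ofFn v) : ℤ) : ℝ)
      have h := convexOn_exp.2 (Set.mem_univ (k * s₁ + w.length * p))
        (Set.mem_univ (k * s₂ + w.length * p)) ha.le hb.le hab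
      simp only [smul_eq_mul] at h
      rw [key]
      calc _ ≤ _ := mul_le_mul_of_nonneg_left h (zpow_pos hx _).le
        _ = _ := by ring
    · simp
  · rw [List.ofFn_get, if_pos hw]
    set k : ℝ := ((yCoord w : ℤ) : ℝ)
    have hk : k ≠ 0 := Int.cast_ne_zero.2 hy
    have h := strictConvexOn_exp.2 (Set.mem_univ (k * s₁ + w.length * p))
      (Set.mem_univ (k * s₂ + w.length * p)) (by simpa [hk] using hs) ha hb hab
    simp only [smul_eq_mul] at h
    rw [key]
    calc _ < _ := mul_lt_mul_of_pos_left h (zpow_pos hx _)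
      _ = _ := by simp only [if_pos hw]; ring

/-- `log ρ` in the logarithmic coordinate of `y`. -/
def logRho (R : Rule) (x s : ℝ) : ℝ := Real.log (rho R x (Real.exp s))

theorem exp_logRho {R : Rule} (hR : Aperiodic R) {x : ℝ} (hx : 0 < x) (s : ℝ) :
    Real.exp (logRho R x s) = rho R x (Real.exp s) :=
  Real.exp_log (rho_pos hR hx (Real.exp_pos s))

theorem hasSum_classB_logRho {R : Rule} (hR : Aperiodic R) {x : ℝ} (hx : 0 < x) (s : ℝ)
    (θ : Step) :
    HasSum (fun m => partitionFn (classB R θ) m x (Real.exp s) * Real.exp (logRho R x s) ^ m) 1 := by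
  rw [exp_logRho hR hx]
  exact hasSum_classB_rho hR hx (Real.exp_pos s) θ

/-- The set where `B ≤ 1` is convex in logarithmic coordinates, and `log ρ` is its upper boundary.
Any `θ` would serve, since `ρ` is the same for all. -/
theorem concaveOn_logRho {R : Rule} (hR : Aperiodic R) {x : ℝ} (hx : 0 < x) :
    ConcaveOn ℝ Set.univ (logRho R x) := by
  refine ⟨convex_univ, fun s₁ _ s₂ _ a b ha hb hab => ?_⟩
  simp only [smul_eq_mul]
  have hle := fun m => partitionFn_convex (classB R Step.south) m hx s₁ s₂ (logRho R x s₁)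
    (logRho R x s₂) ha hb hab
  have h1 := ((hasSum_classB_logRho hR hx s₁ Step.south).mul_left a).add
    ((hasSum_classB_logRho hR hx s₂ Step.south).mul_left b)
  have hs : GFConverges (classB R Step.south) (Real.exp (a * logRho R x s₁ + b * logRho R x s₂)) x
      (Real.exp (a * s₁ + b * s₂)) :=
    Summable.of_nonneg_of_le (fun m => mul_nonneg
      (partitionFn_nonneg _ m hx.le (Real.exp_pos _).le) (pow_nonneg (Real.exp_pos _).le m))
      hle h1.summable
  rw [← Real.exp_le_exp, exp_logRho hR hx]
  refine le_rho_of_gf_le_one hR hx (Real.exp_pos _) hs ?_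
  calc _ ≤ _ := hs.tsum_le_tsum hle h1.summable
    _ = 1 := by rw [h1.tsum_eq]; linarith

/-- A loop of nonzero height has a strictly convex term, so `B_θ < 1` at the midpoint when `t` is
the common value of `ρ`. This is all the strict concavity that uniqueness of the maximiser needs. -/
theorem logRho_midpoint_gt {R : Rule} (hR : Aperiodic R) {x : ℝ} (hx : 0 < x) {w : List Step}
    {θ : Step} (hw : w ∈ classB R θ) (hy : yCoord w ≠ 0) {s₁ s₂ : ℝ} (hs : s₁ ≠ s₂)
    (heq : logRho R x s₁ = logRho R x s₂) :
    logRho R x s₁ < logRho R x (1 / 2 * s₁ + 1 / 2 * s₂) := by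
  have hle : ∀ m, _ := fun m => partitionFn_convex (classB R θ) m hx s₁ s₂ (logRho R x s₁)
    (logRho R x s₁) (a := 1 / 2) (b := 1 / 2) (by norm_num) (by norm_num) (by norm_num)
  have hp : 1 / 2 * logRho R x s₁ + 1 / 2 * logRho R x s₁ = logRho R x s₁ := by ring
  simp only [hp] at hle
  have h2 := hasSum_classB_logRho hR hx s₂ θ
  rw [← heq] at h2
  have h1 := ((hasSum_classB_logRho hR hx s₁ θ).mul_left (1 / 2)).add (h2.mul_left (1 / 2))
  have hsum : GFConverges (classB R θ) (Real.exp (logRho R x s₁)) x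
      (Real.exp (1 / 2 * s₁ + 1 / 2 * s₂)) :=
    Summable.of_nonneg_of_le (fun m => mul_nonneg
      (partitionFn_nonneg _ m hx.le (Real.exp_pos _).le) (pow_nonneg (Real.exp_pos _).le m))
      hle h1.summable
  rw [← Real.exp_lt_exp, exp_logRho hR hx (1 / 2 * s₁ + 1 / 2 * s₂)]
  refine lt_rho_of_gf_lt_one hR hx (Real.exp_pos _) hsum ?_
  calc _ < _ := Summable.tsum_lt_tsum (i := w.length) hle
        (partitionFn_strictConvex hx _ hs hw hy (by norm_num) (by norm_num) (by norm_num))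
        hsum h1.summable
    _ = 1 := by rw [h1.tsum_eq]; norm_num

theorem weight_mul_rho_pow_le_one {R : Rule} (hR : Aperiodic R) {x y : ℝ} (hx : 0 < x)
    (hy : 0 < y) {θ : Step} {w : List Step} (hw : w ∈ classB R θ) :
    x ^ xCoord w * y ^ yCoord w * rho R x y ^ w.length ≤ 1 := by
  classical
  have hsum := hasSum_classB_rho hR hx hy θ
  have hρ := rho_pos hR hx hy
  have h1 : x ^ xCoord w * y ^ yCoord w ≤ partitionFn (classB R θ) w.length x y := by
    rw [partitionFn_eq_sum_ite]
    refine le_trans ?_ (Finset.single_le_sum (fun v _ => ?_) (Finset.mem_univ w.get))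
    · rw [List.ofFn_get, if_pos hw]
    · split_ifs
      · positivity
      · exact le_rfl
  calc _ ≤ _ := mul_le_mul_of_nonneg_right h1 (pow_pos hρ _).le
    _ ≤ 1 := le_hasSum hsum w.length fun m _ =>
      mul_nonneg (partitionFn_nonneg _ m hx.le hy.le) (pow_pos hρ m).le

/-- A single term of `B_θ(ρ) = 1` is at most 1; taking logarithms, each loop gives an affine upper
bound for `log ρ`. -/
theorem length_mul_logRho_le {R : Rule} (hR : Aperiodic R) {x : ℝ} (hx : 0 < x) {θ : Step}
    {w : List Step} (hw : w ∈ classB R θ) (s : ℝ) :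
    w.length * logRho R x s ≤ -(xCoord w * Real.log x) - yCoord w * s := by
  have h := weight_mul_rho_pow_le_one hR hx (Real.exp_pos s) hw
  have hρ := rho_pos hR hx (Real.exp_pos s)
  have h2 := Real.log_le_log (by have := Real.exp_pos s; positivity) h
  rw [Real.log_mul (by have := Real.exp_pos s; positivity) (by positivity),
    Real.log_mul (by positivity) (by have := Real.exp_pos s; positivity), Real.log_pow,
    Real.log_zpow, Real.log_zpow, Real.log_exp, Real.log_one] at h2
  rw [logRho]
  linarith

/-- Cut the walk at the first return to `θ`. What precedes that return contains neither vertical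
direction, so only the final `θ` contributes to the height. -/
theorem exists_mem_classB_of_repeat {R : Rule} {θ θ' : Step}
    (hdy : ∀ φ, φ ≠ θ → φ ≠ θ' → φ.dy = 0) {l : List Step}
    (hl : Obeys R ([θ] ++ l ++ [θ])) (hθ' : θ' ∉ l) :
    ∃ w ∈ classB R θ, yCoord w = θ.dy := by
  obtain ⟨l₁, l₂, hθ, hpre⟩ : ∃ l₁ l₂, θ ∉ l₁ ∧ l ++ [θ] = l₁ ++ θ :: l₂ ∧ θ' ∉ l₁ := by
    by_cases h : θ ∈ l
    · obtain ⟨l₁, l₂, rfl, h1⟩ := List.eq_append_cons_of_mem h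
      exact ⟨l₁, l₂ ++ [θ], h1, by simp, fun h => hθ' (by simp [h])⟩
    · exact ⟨l, [], h, rfl, hθ'⟩
  obtain ⟨heq, h'⟩ := hpre
  have hob : Obeys R (θ :: (l₁ ++ [θ])) := by
    have : [θ] ++ l ++ [θ] = (θ :: (l₁ ++ [θ])) ++ l₂ := by
      rw [List.append_assoc, heq]; simp
    rw [this] at hl
    exact (List.isChain_append.1 hl).1
  refine ⟨l₁ ++ [θ], ⟨⟨hob.tail, by simp, ?_⟩, ?_⟩, ?_⟩
  · simp [List.count_append, List.count_eq_zero_of_not_mem hθ]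
  · cases l₁ with
    | nil => exact ⟨θ, rfl, (List.isChain_cons_cons.1 hob).1⟩
    | cons φ l => exact ⟨φ, rfl, (List.isChain_cons_cons.1 hob).1⟩
  · have h0 : (l₁.map Step.dy).sum = 0 := by
      refine List.sum_eq_zero fun a ha => ?_
      obtain ⟨φ, hφ, rfl⟩ := List.mem_map.1 ha
      exact hdy φ (fun h => hθ (h ▸ hφ)) fun h => h' (h ▸ hφ)
    simp [yCoord, h0]

theorem exists_mem_classB_south {R : Rule} (h : ¬ NorthBound R) :
    ∃ w ∈ classB R Step.south, yCoord w = -1 := by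
  simp only [NorthBound, not_forall] at h
  obtain ⟨l, h1, h2⟩ := h
  exact exists_mem_classB_of_repeat (θ' := Step.north)
    (fun φ => by cases φ <;> simp [Step.dy]) h1 h2

theorem exists_mem_classB_north {R : Rule} (h : ¬ SouthBound R) :
    ∃ w ∈ classB R Step.north, yCoord w = 1 := by
  simp only [SouthBound, not_forall] at h
  obtain ⟨l, h1, h2⟩ := h
  exact exists_mem_classB_of_repeat (θ' := Step.south)
    (fun φ => by cases φ <;> simp [Step.dy]) h1 h2

theorem length_pos_of_mem_classB {R : Rule} {θ : Step} {w : List Step} (h : w ∈ classB R θ) :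
    0 < w.length := by
  rw [List.length_pos_iff]
  rintro rfl
  obtain ⟨-, φ, h, -⟩ := h
  simp at h

/-- The loop of height -1 bounds `log ρ` by an increasing affine function of `s`, the loop of height
1 by a decreasing one. A concave function on the line is continuous, so it attains its maximum. -/
theorem exists_forall_logRho_le {R : Rule} (hR : Aperiodic R) (hV : VerticallyUnbounded R) {x : ℝ}
    (hx : 0 < x) : ∃ s₀, ∀ s, logRho R x s ≤ logRho R x s₀ := by
  have hcont : Continuous (logRho R x) := by
    rw [← continuousOn_univ]
    exact (concaveOn_logRho hR hx).continuousOn isOpen_univ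
  refine hcont.exists_forall_ge' 0 ?_
  rw [cocompact_eq_atBot_atTop, eventually_sup]
  constructor
  · obtain ⟨w, hw, hy⟩ := exists_mem_classB_south hV.1
    filter_upwards [eventually_le_atBot (w.length * logRho R x 0 + xCoord w * Real.log x)] with s hs
    have h := length_mul_logRho_le hR hx hw s
    have hl : (0 : ℝ) < w.length := Nat.cast_pos.2 (length_pos_of_mem_classB hw)
    rw [hy] at h
    push_cast at h
    exact le_of_mul_le_mul_left (by linarith) hl
  · obtain ⟨w, hw, hy⟩ := exists_mem_classB_north hV.2
    filter_upwards [eventually_ge_atTop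
      (-(w.length * logRho R x 0 + xCoord w * Real.log x))] with s hs
    have h := length_mul_logRho_le hR hx hw s
    have hl : (0 : ℝ) < w.length := Nat.cast_pos.2 (length_pos_of_mem_classB hw)
    rw [hy] at h
    push_cast at h
    exact le_of_mul_le_mul_left (by linarith) hl

theorem eq_of_forall_logRho_le {R : Rule} (hR : Aperiodic R) (hV : VerticallyUnbounded R) {x : ℝ}
    (hx : 0 < x) {s₁ s₂ : ℝ} (h₁ : ∀ s, logRho R x s ≤ logRho R x s₁)
    (h₂ : logRho R x s₁ ≤ logRho R x s₂) : s₁ = s₂ := by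
  by_contra hne
  obtain ⟨w, hw, hy⟩ := exists_mem_classB_south hV.1
  exact absurd (h₁ _) (not_le.2 (logRho_midpoint_gt hR hx hw (by rw [hy]; norm_num) hne
    (le_antisymm h₂ (h₁ s₂))))

/-! ### Analyticity of the hitting series in `y` near a positive point. -/

theorem stepWeight_le {x y z c : ℝ} (hx : 0 < x) (hy : 0 < y) (hc : 1 ≤ c)
    (h1 : y / c ≤ z) (h2 : z ≤ y * c) (φ : Step) :
    stepWeight x z φ ≤ c * stepWeight x y φ := by
  have hc0 : 0 < c := one_pos.trans_le hc
  have hz : 0 < z := (div_pos hy hc0).trans_le h1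
  cases φ
  · simpa [stepWeight, Step.dx, Step.dy] using le_mul_of_one_le_left hx.le hc
  · simpa [stepWeight, Step.dx, Step.dy, mul_comm] using h2
  · simpa [stepWeight, Step.dx, Step.dy] using le_mul_of_one_le_left (inv_pos.2 hx).le hc
  · simp only [stepWeight, Step.dx, Step.dy, zpow_zero, one_mul, zpow_neg, zpow_one]
    rw [← div_eq_mul_inv, le_div_iff₀ hy, inv_mul_le_iff₀ hz]
    rwa [div_le_iff₀ hc0] at h1

theorem norm_stepWeight {x : ℝ} (hx : 0 < x) (z : ℂ) (φ : Step) :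
    ‖stepWeight (x : ℂ) z φ‖ = stepWeight x ‖z‖ φ := by
  simp [stepWeight, norm_zpow, abs_of_pos hx]

theorem ofReal_stepWeight (x y : ℝ) (φ : Step) :
    ((stepWeight x y φ : ℝ) : ℂ) = stepWeight (x : ℂ) (y : ℂ) φ := by
  simp [stepWeight]

theorem ofReal_ruleInd (R : Rule) (φ ψ : Step) : ((ruleInd R φ ψ : ℝ) : ℂ) = ruleInd R φ ψ := by
  unfold ruleInd
  split_ifs <;> simp

theorem ofReal_hitSum (R : Rule) (θ : Step) (a : Step → ℝ) (φ : Step) :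
    ((hitSum R θ a φ : ℝ) : ℂ) = hitSum R θ (fun χ => (a χ : ℂ)) φ := by
  rw [hitSum, Complex.ofReal_tsum]
  exact tsum_congr fun m => map_hit Complex.ofRealHom R θ a m φ

theorem ofReal_returnSum (R : Rule) (θ : Step) (a : Step → ℝ) :
    ((returnSum R θ a : ℝ) : ℂ) = returnSum R θ (fun χ => (a χ : ℂ)) := by
  simp only [returnSum, Complex.ofReal_sum, Complex.ofReal_mul, ofReal_ruleInd, ofReal_hitSum]

theorem differentiableOn_hit (R : Rule) (θ : Step) {a : ℂ → Step → ℂ} {U : Set ℂ}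
    (ha : ∀ φ, DifferentiableOn ℂ (fun z => a z φ) U) (m : ℕ) (φ : Step) :
    DifferentiableOn ℂ (fun z => hit R θ (a z) m φ) U := by
  induction m generalizing φ with
  | zero => exact differentiableOn_const 0
  | succ m ih =>
    simp only [hit]
    by_cases h : φ = θ
    · simp only [h, if_true]
      exact (ha θ).mul (differentiableOn_const _)
    · simp only [h, if_false]
      exact (ha φ).mul (DifferentiableOn.fun_sum fun ψ _ => (ih ψ).const_mul _)

theorem Contracts.differentiableOn_hitSum {R : Rule} {θ : Step} {w v : Step → ℝ} {κ : ℝ}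
    (hc : Contracts R θ w v κ) {a : ℂ → Step → ℂ} {U : Set ℂ} (hU : IsOpen U)
    (ha : ∀ φ, DifferentiableOn ℂ (fun z => a z φ) U) (hle : ∀ z ∈ U, ∀ φ, ‖a z φ‖ ≤ w φ)
    (φ : Step) : DifferentiableOn ℂ (fun z => hitSum R θ (a z) φ) U :=
  Complex.differentiableOn_tsum_of_summable_norm (hc.summable_bound φ)
    (fun m => differentiableOn_hit R θ ha m φ) hU fun m z hz => hc.norm_hit_le (hle z hz) m φ

theorem Contracts.differentiableOn_returnSum {R : Rule} {θ : Step} {w v : Step → ℝ} {κ : ℝ}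
    (hc : Contracts R θ w v κ) {a : ℂ → Step → ℂ} {U : Set ℂ} (hU : IsOpen U)
    (ha : ∀ φ, DifferentiableOn ℂ (fun z => a z φ) U) (hle : ∀ z ∈ U, ∀ φ, ‖a z φ‖ ≤ w φ) :
    DifferentiableOn ℂ (fun z => returnSum R θ (a z)) U :=
  DifferentiableOn.fun_sum fun φ _ => (hc.differentiableOn_hitSum hU ha hle φ).const_mul _

/-- Derivatives in the statement are real while analyticity is obtained over `ℂ`; a function real on
the real axis has a real derivative there. -/
theorem hasDerivAt_of_complex {F : ℂ → ℂ} {g : ℝ → ℝ} {p : ℝ} {F' : ℂ}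
    (hF : HasDerivAt F F' (p : ℂ)) (hg : ∀ᶠ t : ℝ in 𝓝 p, F (t : ℂ) = (g t : ℂ)) :
    HasDerivAt g F'.re p ∧ F' = (F'.re : ℂ) := by
  have h1 : HasDerivAt g F'.re p := by
    refine hF.real_of_complex.congr_of_eventuallyEq ?_
    filter_upwards [hg] with t ht
    rw [ht, Complex.ofReal_re]
  refine ⟨h1, ?_⟩
  have h2 : HasDerivAt (fun t : ℝ => (g t : ℂ)) F' p := by
    refine hF.comp_ofReal.congr_of_eventuallyEq ?_
    filter_upwards [hg] with t ht
    exact ht.symm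
  exact h2.unique h1.ofReal_comp

theorem Contracts.exists_dilation {R : Rule} {θ : Step} {w v : Step → ℝ} {κ : ℝ}
    (hc : Contracts R θ w v κ) :
    ∃ c : ℝ, 1 < c ∧ Contracts R θ (fun φ => c * w φ) v (c * κ) := by
  have h1 := hc.κ_pos
  have h2 := hc.κ_lt_one
  have h3 : 1 < κ⁻¹ := (one_lt_inv₀ h1).2 h2
  -- The midpoint of `1` and `κ⁻¹` exceeds 1 and keeps the new factor `c * κ` below 1.
  refine ⟨(1 + κ⁻¹) / 2, by linarith, hc.mono (by linarith) ?_ fun φ => le_rfl⟩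
  have : (1 + κ⁻¹) / 2 * κ = (κ + 1) / 2 := by field_simp
  linarith

/-- The contraction leaves room for a factor `c > 1` in all weights. Moving `y` within the annulus
between `y / c` and `y * c` costs no more, so the series converges uniformly there. -/
theorem Contracts.gf_classB_vertical {R : Rule} {θ : Step} {x y t : ℝ} (hx : 0 < x) (hy : 0 < y)
    (ht : 0 < t) {v : Step → ℝ} {κ : ℝ}
    (hc : Contracts R θ (fun φ => t * stepWeight x y φ) v κ) :
    (∀ᶠ z in 𝓝 y, GFConverges (classB R θ) t x z) ∧
      DifferentiableAt ℝ (fun z => gf (classB R θ) t x z) y := by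
  obtain ⟨c, hc1, hc'⟩ := hc.exists_dilation
  have hc0 : 0 < c := one_pos.trans hc1
  let U : Set ℂ := {z | ‖z‖ ∈ Set.Ioo (y / c) (y * c)}
  have hU : IsOpen U := isOpen_Ioo.preimage continuous_norm
  have hyU : ∀ᶠ z in 𝓝 y, z ∈ Set.Ioo (y / c) (y * c) :=
    Ioo_mem_nhds (div_lt_self hy hc1) (lt_mul_of_one_lt_right hy hc1)
  have hle : ∀ z ∈ U, ∀ φ, ‖(t : ℂ) * stepWeight (x : ℂ) z φ‖ ≤ c * (t * stepWeight x y φ) := by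
    intro z hz φ
    rw [norm_mul, Complex.norm_real, Real.norm_of_nonneg ht.le, norm_stepWeight hx]
    calc t * stepWeight x ‖z‖ φ ≤ t * (c * stepWeight x y φ) :=
          mul_le_mul_of_nonneg_left (stepWeight_le hx hy hc1.le hz.1.le hz.2.le φ) ht.le
      _ = _ := by ring
  have hsum : ∀ z ∈ Set.Ioo (y / c) (y * c),
      HasSum (fun m => partitionFn (classB R θ) m x z * t ^ m)
        (returnSum R θ fun φ => t * stepWeight x z φ) := by
    intro z hz
    have hz0 : 0 < z := (div_pos hy hc0).trans hz.1
    refine hasSum_classB hc' hx hz0 fun φ => ?_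
    have := hle (z : ℂ) (by simpa [U, abs_of_pos hz0] using hz) φ
    rwa [← ofReal_stepWeight, ← Complex.ofReal_mul, Complex.norm_real] at this
  have hdiff : DifferentiableOn ℂ
      (fun z => returnSum R θ fun φ => (t : ℂ) * stepWeight (x : ℂ) z φ) U := by
    refine hc'.differentiableOn_returnSum hU (fun φ => ?_) hle
    refine DifferentiableOn.const_mul (DifferentiableOn.const_mul (fun z hz => ?_) _) _
    refine (differentiableAt_zpow.2 (Or.inl ?_)).differentiableWithinAt
    rintro rfl
    have := hz.1
    simp only [norm_zero] at this
    exact absurd (div_pos hy hc0) this.not_gt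
  refine ⟨hyU.mono fun z hz => (hsum z hz).summable, ?_⟩
  have hmem : (y : ℂ) ∈ U := by
    simpa [U, abs_of_pos hy] using hyU.self_of_nhds
  have h1 := (hdiff.differentiableAt (hU.mem_nhds hmem)).hasDerivAt
  refine (hasDerivAt_of_complex h1 ?_).1.differentiableAt
  filter_upwards [hyU] with z hz
  rw [gf, (hsum z hz).tsum_eq, ofReal_returnSum]
  simp [ofReal_stepWeight]

theorem gf_classB_rho_vertical {R : Rule} (hR : Aperiodic R) {x y : ℝ} (hx : 0 < x) (hy : 0 < y)
    (θ : Step) :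
    (∀ᶠ z in 𝓝 y, GFConverges (classB R θ) (rho R x y) x z) ∧
      DifferentiableAt ℝ (fun z => gf (classB R θ) (rho R x y) x z) y := by
  obtain ⟨u, hu⟩ := exists_isPerron_rho hR hx hy
  obtain ⟨v, κ, hc⟩ := hu.exists_contracts hR (stepWeight_pos hx hy) θ
  exact hc.gf_classB_vertical hx hy hu.ρ_pos

/-! ### Existence and uniqueness of `τ`, and positivity of the `y`-derivative. -/

/-- With no constant term, dividing `t` by `β ≥ 1` divides the series by at least `β`, so `B(t / β)
≤ 1` when `β = B(t)`. -/
theorem rho_div_gf_le {R : Rule} (hR : Aperiodic R) {x z t : ℝ} (hx : 0 < x) (hz : 0 < z)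
    (ht : 0 < t) {θ : Step} (hconv : GFConverges (classB R θ) t x z)
    (h1 : 1 ≤ gf (classB R θ) t x z) : t / gf (classB R θ) t x z ≤ rho R x z := by
  set β := gf (classB R θ) t x z with hβ
  have hβ0 : 0 < β := one_pos.trans_le h1
  have hle : ∀ m, partitionFn (classB R θ) m x z * (t / β) ^ m
      ≤ β⁻¹ * (partitionFn (classB R θ) m x z * t ^ m) := by
    intro m
    rcases Nat.eq_zero_or_pos m with rfl | hm
    · simp [partitionFn_classB_zero R θ hx hz]
    · have h2 : (β⁻¹) ^ m ≤ β⁻¹ := pow_le_of_le_one (inv_pos.2 hβ0).le (inv_le_one_of_one_le₀ h1)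
        hm.ne'
      have h3 : 0 ≤ partitionFn (classB R θ) m x z * t ^ m :=
        mul_nonneg (partitionFn_nonneg _ m hx.le hz.le) (pow_pos ht m).le
      calc _ = (β⁻¹) ^ m * (partitionFn (classB R θ) m x z * t ^ m) := by
            rw [div_eq_mul_inv, mul_pow]; ring
        _ ≤ _ := mul_le_mul_of_nonneg_right h2 h3
  have hs : GFConverges (classB R θ) (t / β) x z := Summable.of_nonneg_of_le
    (fun m => mul_nonneg (partitionFn_nonneg _ m hx.le hz.le) (pow_pos (div_pos ht hβ0) m).le)
    hle (hconv.mul_left _)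
  refine le_rho_of_gf_le_one hR hx hz hs ?_
  calc _ ≤ _ := hs.tsum_le_tsum hle (hconv.mul_left _)
    _ = β⁻¹ * β := by rw [tsum_mul_left, hβ, gf]
    _ = 1 := inv_mul_cancel₀ hβ0.ne'

/-- Differentiability of `ρ` is needed only at its maximum, where a squeeze gives it: with `β z =
B(ρ(x, τ); x, z)`, one has `ρ(x, τ) / β z ≤ ρ(x, z) ≤ ρ(x, τ)` near `τ`. Here `β` has a local
minimum at `τ`, so the lower bound also has derivative zero. -/
theorem hasDerivAt_rho_zero_of_max {R : Rule} (hR : Aperiodic R) {x τ : ℝ} (hx : 0 < x)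
    (hτ : 0 < τ) (hmax : ∀ z, 0 < z → rho R x z ≤ rho R x τ) :
    HasDerivAt (fun y => rho R x y) 0 τ := by
  obtain ⟨hconv, hdiff⟩ := gf_classB_rho_vertical hR hx hτ Step.south
  have hρ := rho_pos hR hx hτ
  set β : ℝ → ℝ := fun z => gf (classB R Step.south) (rho R x τ) x z with hβ
  have hβτ : β τ = 1 := (hasSum_classB_rho hR hx hτ Step.south).tsum_eq
  have hpos : ∀ᶠ z in 𝓝 τ, 0 < z := lt_mem_nhds hτ
  have hge : ∀ᶠ z in 𝓝 τ, 1 ≤ β z := by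
    filter_upwards [hconv, hpos] with z h1 h2
    by_contra! h3
    exact absurd (hmax z h2) (not_le.2 (lt_rho_of_gf_lt_one hR hx h2 h1 h3))
  have hmin : IsLocalMin β τ := by
    filter_upwards [hge] with z hz
    rwa [hβτ]
  have hd : HasDerivAt β 0 τ := by
    have := hdiff.hasDerivAt
    rwa [hmin.deriv_eq_zero] at this
  have hq : HasDerivAt (fun z => rho R x τ / β z) 0 τ := by
    have : HasDerivAt (fun z => rho R x τ / β z) _ τ :=
      (hasDerivAt_const τ (rho R x τ)).div hd (by rw [hβτ]; exact one_ne_zero)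
    simpa using this
  rw [hasDerivAt_iff_isLittleO] at hq ⊢
  refine IsBigO.trans_isLittleO (IsBigO.of_bound 1 ?_) hq
  filter_upwards [hconv, hpos, hge] with z h1 h2 h3
  have h4 := rho_div_gf_le hR hx h2 hρ h1 h3
  have h5 := hmax z h2
  simp only [hβτ, div_one, smul_zero, sub_zero, one_mul, Real.norm_eq_abs]
  rw [abs_sub_comm, abs_of_nonneg (sub_nonneg.2 h5), abs_sub_comm,
    abs_of_nonneg (sub_nonneg.2 (h4.trans h5))]
  exact sub_le_sub_left h4 _

/-- A concave function lies below its tangent, which is horizontal here. -/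
theorem IsTau.forall_logRho_le {R : Rule} (hR : Aperiodic R) {x τ : ℝ} (hx : 0 < x)
    (h : IsTau R x τ) (s : ℝ) : logRho R x s ≤ logRho R x (Real.log τ) := by
  obtain ⟨hτ, hd⟩ := h
  have hd' : HasDerivAt (logRho R x) 0 (Real.log τ) := by
    have h1 : HasDerivAt (fun y => rho R x y) 0 (Real.exp (Real.log τ)) := by
      rwa [Real.exp_log hτ]
    have h2 : HasDerivAt (logRho R x) _ _ :=
      (h1.comp (Real.log τ) (Real.hasDerivAt_exp (Real.log τ))).log (rho_pos hR hx (Real.exp_pos _)).ne'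
    simpa using h2
  have hconc := concaveOn_logRho hR hx
  rcases lt_trichotomy s (Real.log τ) with hlt | heq | hgt
  · have := hconc.le_slope_of_hasDerivAt (Set.mem_univ s) (Set.mem_univ _) hlt hd'
    rw [slope_def_field, le_div_iff₀ (sub_pos.2 hlt)] at this
    linarith
  · rw [heq]
  · have := hconc.slope_le_of_hasDerivAt (Set.mem_univ _) (Set.mem_univ s) hgt hd'
    rw [slope_def_field, div_le_iff₀ (sub_pos.2 hgt)] at this
    linarith

theorem existsUnique_isTau {R : Rule} (hR : Aperiodic R) (hV : VerticallyUnbounded R) {x : ℝ}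
    (hx : 0 < x) : ∃! τ : ℝ, IsTau R x τ := by
  obtain ⟨s₀, hs₀⟩ := exists_forall_logRho_le hR hV hx
  refine ⟨Real.exp s₀, ⟨Real.exp_pos s₀, hasDerivAt_rho_zero_of_max hR hx (Real.exp_pos s₀)
    fun z hz => ?_⟩, fun τ hτ => ?_⟩
  · have := Real.exp_le_exp.2 (hs₀ (Real.log z))
    rwa [exp_logRho hR hx, exp_logRho hR hx, Real.exp_log hz] at this
  · rw [eq_of_forall_logRho_le hR hV hx hs₀ (hτ.forall_logRho_le hR hx s₀), Real.exp_log hτ.1]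

theorem IsTau.rho_lt {R : Rule} (hR : Aperiodic R) (hV : VerticallyUnbounded R) {x τ y : ℝ}
    (hx : 0 < x) (h : IsTau R x τ) (hy : τ < y) : rho R x y < rho R x τ := by
  have hy0 : 0 < y := h.1.trans hy
  by_contra! hle
  have h1 : logRho R x (Real.log τ) ≤ logRho R x (Real.log y) := by
    rw [logRho, logRho, Real.exp_log h.1, Real.exp_log hy0]
    exact Real.log_le_log (rho_pos hR hx h.1) hle
  have := eq_of_forall_logRho_le hR hV hx (h.forall_logRho_le hR hx) h1
  exact hy.ne (Real.log_injOn_pos h.1 hy0 this)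

/-- With `t = ρ(x, y)` fixed, `B_θ` is convex in `log y`, below 1 at `log τ` because `ρ(x, y) < ρ(x,
τ)`, and equal to 1 at `log y`. The derivative at the right end is at least this positive slope. -/
theorem dyB_pos {R : Rule} (hR : Aperiodic R) (hV : VerticallyUnbounded R) {x τ y : ℝ}
    (hx : 0 < x) (h : IsTau R x τ) (hy : τ < y) (θ : Step) : 0 < dyB R θ x y := by
  have hy0 : 0 < y := h.1.trans hy
  have hρ := rho_pos hR hx hy0
  set p := Real.log (rho R x y)
  have hp : Real.exp p = rho R x y := Real.exp_log hρ
  set g : ℝ → ℝ := fun s => gf (classB R θ) (rho R x y) x (Real.exp s) with hg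
  have hst : Real.log τ < Real.log y := Real.log_lt_log h.1 hy
  obtain ⟨hτc, hτ1⟩ := gf_classB_lt_one hR hx h.1 θ hρ.le (h.rho_lt hR hV hx hy)
  have hyc := hasSum_classB_rho hR hx hy0 θ
  have hle : ∀ (s₁ s₂ a b : ℝ), 0 ≤ a → 0 ≤ b → a + b = 1 → ∀ m,
      partitionFn (classB R θ) m x (Real.exp (a * s₁ + b * s₂)) * rho R x y ^ m
      ≤ a * (partitionFn (classB R θ) m x (Real.exp s₁) * rho R x y ^ m)
        + b * (partitionFn (classB R θ) m x (Real.exp s₂) * rho R x y ^ m) := by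
    intro s₁ s₂ a b ha hb hab m
    have := partitionFn_convex (classB R θ) m hx s₁ s₂ p p ha hb hab
    rwa [← add_mul, hab, one_mul, hp] at this
  have hterm : ∀ s m, 0 ≤ partitionFn (classB R θ) m x (Real.exp s) * rho R x y ^ m := fun s m =>
    mul_nonneg (partitionFn_nonneg _ m hx.le (Real.exp_pos _).le) (pow_pos hρ m).le
  have hconv : ∀ s ∈ Set.Icc (Real.log τ) (Real.log y),
      GFConverges (classB R θ) (rho R x y) x (Real.exp s) := by
    intro s hs
    rw [← segment_eq_Icc hst.le] at hs
    obtain ⟨a, b, ha, hb, hab, rfl⟩ := hs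
    refine Summable.of_nonneg_of_le (hterm _) (hle _ _ a b ha hb hab) ?_
    rw [Real.exp_log h.1, Real.exp_log hy0]
    exact (hτc.mul_left _).add (hyc.summable.mul_left _)
  have hconvex : ConvexOn ℝ (Set.Icc (Real.log τ) (Real.log y)) g := by
    refine ⟨convex_Icc _ _, fun s₁ h₁ s₂ h₂ a b ha hb hab => ?_⟩
    have h12 := ((hconv s₁ h₁).hasSum.mul_left a).add ((hconv s₂ h₂).hasSum.mul_left b)
    have h3 := (hconv _ (convex_Icc _ _ h₁ h₂ ha hb hab)).tsum_le_tsum (hle s₁ s₂ a b ha hb hab)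
      h12.summable
    rw [h12.tsum_eq] at h3
    exact h3
  have hd : HasDerivAt g (dyB R θ x y * y) (Real.log y) := by
    have h1 : HasDerivAt (fun z => gf (classB R θ) (rho R x y) x z) (dyB R θ x y)
        (Real.exp (Real.log y)) := by
      rw [Real.exp_log hy0]
      exact (gf_classB_rho_vertical hR hx hy0 θ).2.hasDerivAt
    have := h1.comp (Real.log y) (Real.hasDerivAt_exp (Real.log y))
    rwa [Real.exp_log hy0] at this
  have hslope := hconvex.slope_le_of_hasDerivAt (Set.left_mem_Icc.2 hst.le)
    (Set.right_mem_Icc.2 hst.le) hst hd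
  have hgτ : g (Real.log τ) < 1 := by simpa only [hg, Real.exp_log h.1] using hτ1
  have hgy : g (Real.log y) = 1 := by
    simp only [hg, Real.exp_log hy0]
    exact hyc.tsum_eq
  have h0 : 0 < slope g (Real.log τ) (Real.log y) := by
    rw [slope_def_field]
    exact div_pos (by linarith) (sub_pos.2 hst)
  exact pos_of_mul_pos_left (h0.trans_le hslope) hy0.le

/-! ### Growth of half-plane walks. -/

theorem partitionFn_classH_succ_le (R : Rule) (θ : Step) {x y : ℝ} (hx : 0 < x) (hy : 0 < y)
    (m : ℕ) :
    partitionFn (classH R θ) (m + 1) x y ≤ stepWeight x y θ *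
      ((if m = 0 then 1 else 0) + ∑ φ, ruleInd R φ θ * partitionFn (classH R φ) m x y) := by
  by_cases hθ : θ = Step.south
  · subst hθ
    rw [partitionFn_classH_south_succ R hx.ne' hy.ne']
    refine mul_le_mul_of_nonneg_left ?_ (stepWeight_pos hx hy _).le
    have h1 := partitionFn_nonneg (classHstar R) m hx.le (le_refl (0 : ℝ))
    have h2 : (0 : ℝ) ≤ if m = 0 then 1 else 0 := by split_ifs <;> norm_num
    linarith
  · exact (partitionFn_classH_succ R hθ hx.ne' hy.ne' m).le

theorem IsPerron.partitionFn_classH_le {R : Rule} {x y : ℝ} (hx : 0 < x) (hy : 0 < y) {ρ : ℝ}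
    {u : Step → ℝ} (h : IsPerron R (stepWeight x y) ρ u) :
    ∃ C : ℝ, ∀ m φ, partitionFn (classH R φ) m x y * ρ ^ m ≤ C := by
  have hs := stepWeight_pos hx hy
  have hρ := h.ρ_pos
  -- Walks grow at their last step, so each is weighted by the Perron mass `v` of its possible
  -- continuations. Then `K` gains `∑ φ, u φ` at the first step and never increases afterwards.
  set v : Step → ℝ := fun φ => ∑ ψ, ruleInd R φ ψ * u ψ with hv
  have hsv : ∀ φ, u φ = ρ * (stepWeight x y φ * v φ) := fun φ => by
    rw [← mul_assoc]; exact h.eq φ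
  have hvpos : ∀ φ, 0 < v φ := fun φ =>
    pos_of_mul_pos_right (pos_of_mul_pos_right (hsv φ ▸ h.u_pos φ) hρ.le) (hs φ).le
  have hH : ∀ m φ, 0 ≤ partitionFn (classH R φ) m x y :=
    fun m φ => partitionFn_nonneg _ m hx.le hy.le
  set K : ℕ → ℝ := fun m => (∑ φ, partitionFn (classH R φ) m x y * v φ) * ρ ^ m with hK
  have hrec : ∀ m, K (m + 1) ≤ (if m = 0 then ∑ φ, u φ else 0) + K m := by
    intro m
    calc K (m + 1) ≤ (∑ θ, stepWeight x y θ * ((if m = 0 then 1 else 0)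
          + ∑ φ, ruleInd R φ θ * partitionFn (classH R φ) m x y) * v θ) * ρ ^ (m + 1) := by
          refine mul_le_mul_of_nonneg_right (Finset.sum_le_sum fun θ _ => ?_) (pow_pos hρ _).le
          exact mul_le_mul_of_nonneg_right (partitionFn_classH_succ_le R θ hx hy m) (hvpos θ).le
      _ = (∑ θ, u θ * ((if m = 0 then 1 else 0)
          + ∑ φ, ruleInd R φ θ * partitionFn (classH R φ) m x y)) * ρ ^ m := by
          rw [pow_succ', ← mul_assoc, Finset.sum_mul]
          congr 1
          refine Finset.sum_congr rfl fun θ _ => ?_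
          rw [hsv θ]
          ring
      _ = (if m = 0 then ∑ φ, u φ else 0) + K m := by
          have h1 : ∑ θ, u θ * ∑ φ, ruleInd R φ θ * partitionFn (classH R φ) m x y
              = ∑ φ, partitionFn (classH R φ) m x y * v φ := by
            simp only [hv, Finset.mul_sum]
            rw [Finset.sum_comm]
            exact Finset.sum_congr rfl fun φ _ => Finset.sum_congr rfl fun θ _ => by ring
          simp only [mul_add, Finset.sum_add_distrib, h1, add_mul]
          by_cases hm : m = 0
          · simp [hm, hK]
          · simp [hm, hK]
  have hu0 : 0 ≤ ∑ φ, u φ := Finset.sum_nonneg fun φ _ => (h.u_pos φ).le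
  have hKle : ∀ m, K m ≤ if m = 0 then 0 else ∑ φ, u φ := by
    intro m
    induction m with
    | zero => simp [hK, partitionFn_classH_zero]
    | succ m ih =>
      refine (hrec m).trans ?_
      by_cases hm : m = 0
      · simp only [hm, if_true] at ih
        simpa [hm] using ih
      · simpa [hm] using ih
  refine ⟨∑ φ, (∑ ψ, u ψ) / v φ, fun m φ => ?_⟩
  have h1 : partitionFn (classH R φ) m x y * v φ * ρ ^ m ≤ ∑ ψ, u ψ := by
    refine le_trans ?_ ((hKle m).trans ?_)
    · exact mul_le_mul_of_nonneg_right (Finset.single_le_sum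
        (f := fun φ => partitionFn (classH R φ) m x y * v φ)
        (fun ψ _ => mul_nonneg (hH m ψ) (hvpos ψ).le) (Finset.mem_univ φ)) (pow_pos hρ m).le
    · split_ifs
      exacts [hu0, le_rfl]
  calc partitionFn (classH R φ) m x y * ρ ^ m ≤ (∑ ψ, u ψ) / v φ := by
        rw [le_div_iff₀ (hvpos φ)]
        linarith
    _ ≤ _ := Finset.single_le_sum (f := fun φ => (∑ ψ, u ψ) / v φ)
        (fun ψ _ => div_nonneg hu0 (hvpos ψ).le) (Finset.mem_univ φ)

theorem summable_norm_of_mul_pow_le {a : ℕ → ℝ} (ha : ∀ m, 0 ≤ a m) {p C : ℝ} (hp : 0 < p)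
    (hC : ∀ m, a m * p ^ m ≤ C) {t : ℝ} (ht0 : 0 ≤ t) (ht : t < p) :
    Summable fun m => a m * t ^ m := by
  refine Summable.of_nonneg_of_le (fun m => mul_nonneg (ha m) (pow_nonneg ht0 m)) (fun m => ?_)
    ((summable_geometric_of_lt_one (div_nonneg ht0 hp.le) ((div_lt_one hp).2 ht)).mul_left C)
  calc a m * t ^ m = a m * p ^ m * (t / p) ^ m := by
        rw [div_pow, mul_assoc, mul_div_cancel₀ _ (pow_pos hp m).ne']
    _ ≤ _ := mul_le_mul_of_nonneg_right (hC m) (pow_nonneg (div_nonneg ht0 hp.le) m)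

theorem summable_classH {R : Rule} (hR : Aperiodic R) {x y : ℝ} (hx : 0 < x) (hy : 0 < y) {t : ℝ}
    (ht0 : 0 ≤ t) (ht : t < rho R x y) (φ : Step) :
    Summable fun m => partitionFn (classH R φ) m x y * t ^ m := by
  obtain ⟨u, hu⟩ := exists_isPerron_rho hR hx hy
  obtain ⟨C, hC⟩ := hu.partitionFn_classH_le hx hy
  exact summable_norm_of_mul_pow_le (fun m => partitionFn_nonneg _ m hx.le hy.le) hu.ρ_pos
    (fun m => hC m φ) ht0 ht

theorem partitionFn_classH_axis_le (R : Rule) (φ : Step) (m : ℕ) {x y : ℝ} (hx : 0 < x)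
    (hy : 0 < y) : partitionFn (classH R φ) m x 0 ≤ partitionFn (classH R φ) m x y := by
  refine Finset.sum_le_sum fun w _ => mul_le_mul_of_nonneg_left ?_ (zpow_pos hx _).le
  by_cases h : yCoord (List.ofFn w) = 0
  · simp [h]
  · rw [zero_zpow _ h]
    exact (zpow_pos hy _).le

/-- The series does not involve `y`, so any positive `y` may be used for the bound. The choice `y =
τ` gives the largest disc. -/
theorem summable_classHstar_axis {R : Rule} (hR : Aperiodic R) {x y : ℝ} (hx : 0 < x) (hy : 0 < y)
    {t : ℝ} (ht0 : 0 ≤ t) (ht : t < rho R x y) : GFConverges (classHstar R) t x 0 := by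
  simp only [GFConverges, partitionFn_classHstar, Finset.sum_mul, mul_assoc]
  refine summable_sum fun φ _ => Summable.mul_left _ ?_
  exact Summable.of_nonneg_of_le
    (fun m => mul_nonneg (partitionFn_nonneg _ m hx.le le_rfl) (pow_nonneg ht0 m))
    (fun m => mul_le_mul_of_nonneg_right (partitionFn_classH_axis_le R φ m hx hy)
      (pow_nonneg ht0 m)) (summable_classH hR hx hy ht0 ht φ)

/-! ### The kernel equation. -/

/-- The kernel equation for a vector of sequences obeying the half-plane recursion. -/
theorem tsum_mul_one_sub_returnSum {𝕜 : Type*} [NormedField 𝕜] (R : Rule) (θ : Step)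
    {a : Step → 𝕜} {H : ℕ → Step → 𝕜} {g : ℕ → 𝕜} (hhit : ∀ φ, Summable fun m => hit R θ a m φ)
    (hH : ∀ φ, Summable fun m => H m φ) (hg : Summable g) (h0 : ∀ φ, H 0 φ = 0)
    (hrec : ∀ m φ, H (m + 1) φ = a φ * ((if φ = Step.south then -g m else if m = 0 then 1 else 0)
      + ∑ ψ, ruleInd R ψ φ * H m ψ)) :
    (∑' m, H m θ) * (1 - returnSum R θ a)
      = ∑ φ, (if φ ≠ Step.south then 1 else 0) * hitSum R θ a φ
        - hitSum R θ a Step.south * ∑' m, g m := by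
  set Hs : Step → 𝕜 := fun φ => ∑' m, H m φ with hHs
  set G : 𝕜 := ∑' m, g m
  set F := hitSum R θ a with hF
  set e : Step → 𝕜 := fun φ => if φ = θ then 1 else ∑ ψ, ruleInd R φ ψ * F ψ with he
  have hFe : ∀ φ, F φ = a φ * e φ := hitSum_eq R θ hhit
  have hHe : ∀ φ, Hs φ = a φ * ((if φ = Step.south then -G else 1)
      + ∑ ψ, ruleInd R ψ φ * Hs ψ) := by
    intro φ
    rw [hHs]
    simp only
    rw [(hH φ).tsum_eq_zero_add, h0, zero_add]
    simp only [hrec]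
    rw [tsum_mul_left]
    have hs1 : HasSum (fun m => if φ = Step.south then -g m else if m = 0 then (1 : 𝕜) else 0)
        (if φ = Step.south then -G else 1) := by
      split_ifs with h
      · exact hg.hasSum.neg
      · exact hasSum_ite_eq 0 1
    have hs2 : HasSum (fun m => ∑ ψ, ruleInd R ψ φ * H m ψ) (∑ ψ, ruleInd R ψ φ * Hs ψ) :=
      hasSum_sum fun ψ _ => (hH ψ).hasSum.mul_left _
    rw [(hs1.add hs2).tsum_eq]
  -- The pairing of `Hs` with `e` is expanded twice: here by the last-step equations for `Hs`, in
  -- `h2` by the definition of `e`. The double sums are transposes of each other and cancel; the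
  -- defect of `e` at `θ` leaves the factor `1 - returnSum R θ a`.
  have h1 : ∑ φ, Hs φ * e φ = ∑ φ, F φ * (if φ = Step.south then -G else 1)
      + ∑ φ, ∑ ψ, ruleInd R ψ φ * Hs ψ * F φ := by
    rw [← Finset.sum_add_distrib]
    refine Finset.sum_congr rfl fun φ _ => ?_
    rw [← Finset.sum_mul, hFe φ]
    nth_rw 1 [hHe φ]
    ring
  have h2 : ∑ φ, Hs φ * e φ = Hs θ * (1 - returnSum R θ a)
      + ∑ φ, ∑ ψ, ruleInd R φ ψ * Hs φ * F ψ := by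
    have : ∀ φ, Hs φ * e φ = (if φ = θ then Hs θ * (1 - returnSum R θ a) else 0)
        + ∑ ψ, ruleInd R φ ψ * Hs φ * F ψ := by
      intro φ
      have h3 : ∑ ψ, ruleInd R φ ψ * Hs φ * F ψ = Hs φ * ∑ ψ, ruleInd R φ ψ * F ψ := by
        rw [Finset.mul_sum]
        exact Finset.sum_congr rfl fun ψ _ => by ring
      rw [h3, he]
      simp only
      split_ifs with h
      · subst h
        rw [returnSum]
        ring
      · ring
    simp only [this, Finset.sum_add_distrib, Finset.sum_ite_eq', Finset.mem_univ, if_true]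
  rw [h2, Finset.sum_comm (f := fun φ ψ => ruleInd R ψ φ * Hs ψ * F φ)] at h1
  have h3 := add_right_cancel h1
  have h4 : ∀ φ, F φ * (if φ = Step.south then -G else 1)
      = (if φ ≠ Step.south then 1 else 0) * F φ - if φ = Step.south then F Step.south * G else 0 := by
    intro φ
    by_cases h : φ = Step.south <;> simp [h]
  rw [h3]
  simp only [h4, Finset.sum_sub_distrib, Finset.sum_ite_eq', Finset.mem_univ, if_true]

theorem classH_kernel_equation {𝕜 : Type*} [RCLike 𝕜] (R : Rule) (θ : Step) {x y : ℝ} (hx : 0 < x)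
    (hy : 0 < y) (t : 𝕜)
    (hhit : ∀ φ, Summable fun m => hit R θ (fun χ => t * ((stepWeight x y χ : ℝ) : 𝕜)) m φ)
    (hH : ∀ φ, Summable fun m => (partitionFn (classH R φ) m x y : 𝕜) * t ^ m)
    (hg : Summable fun m => (partitionFn (classHstar R) m x 0 : 𝕜) * t ^ m) :
    (∑' m, (partitionFn (classH R θ) m x y : 𝕜) * t ^ m)
        * (1 - returnSum R θ fun χ => t * ((stepWeight x y χ : ℝ) : 𝕜))
      = ∑ φ, (if φ ≠ Step.south then 1 else 0) * hitSum R θ (fun χ => t * ((stepWeight x y χ : ℝ) : 𝕜)) φ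
        - hitSum R θ (fun χ => t * ((stepWeight x y χ : ℝ) : 𝕜)) Step.south
          * ∑' m, (partitionFn (classHstar R) m x 0 : 𝕜) * t ^ m := by
  have hr : ∀ φ ψ, ((ruleInd R φ ψ : ℝ) : 𝕜) = ruleInd R φ ψ := by
    intro φ ψ; unfold ruleInd; split_ifs <;> simp
  refine tsum_mul_one_sub_returnSum R θ hhit hH hg (fun φ => ?_) (fun m φ => ?_)
  · simp [partitionFn_classH_zero]
  · have hsum : ∑ ψ, ruleInd R ψ φ * ((partitionFn (classH R ψ) m x y : 𝕜) * t ^ m)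
        = (∑ ψ, ruleInd R ψ φ * (partitionFn (classH R ψ) m x y : 𝕜)) * t ^ m := by
      rw [Finset.sum_mul]
      exact Finset.sum_congr rfl fun ψ _ => by ring
    rw [hsum]
    by_cases h : φ = Step.south
    · subst h
      rw [partitionFn_classH_south_succ R hx.ne' hy.ne']
      push_cast
      simp only [hr, if_true]
      ring
    · rw [partitionFn_classH_succ R h hx.ne' hy.ne']
      push_cast
      simp only [hr, h, if_false]
      by_cases hm : m = 0
      · simp [hm]
        ring
      · simp [hm]
        ring

/-! ### Positivity of the numerator of `c⁺`. -/

/-- The only south step is the last one, so multiplying by `y` cancels the only negative power of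
`y`. -/
theorem mul_hit_south_mono (R : Rule) {x y₁ y₂ t : ℝ} (hx : 0 < x) (h₁ : 0 < y₁) (h : y₁ ≤ y₂)
    (ht : 0 < t) (m : ℕ) (φ : Step) :
    y₁ * hit R Step.south (fun χ => t * stepWeight x y₁ χ) m φ
      ≤ y₂ * hit R Step.south (fun χ => t * stepWeight x y₂ χ) m φ := by
  have h₂ : 0 < y₂ := h₁.trans_le h
  induction m generalizing φ with
  | zero => simp [hit]
  | succ m ih =>
    simp only [hit]
    by_cases hφ : φ = Step.south
    · subst hφ
      refine le_of_eq ?_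
      simp only [stepWeight, Step.dx, Step.dy, if_true, zpow_zero, zpow_neg, zpow_one, one_mul]
      field_simp
    · simp only [hφ, if_false]
      have hs : stepWeight x y₁ φ ≤ stepWeight x y₂ φ := by
        cases φ
        · simp [stepWeight, Step.dx, Step.dy]
        · simpa [stepWeight, Step.dx, Step.dy] using h
        · simp [stepWeight, Step.dx, Step.dy]
        · exact absurd rfl hφ
      have hsum : ∀ y, y * (t * stepWeight x y φ * ∑ ψ, ruleInd R φ ψ *
          hit R Step.south (fun χ => t * stepWeight x y χ) m ψ)
          = t * stepWeight x y φ * ∑ ψ, ruleInd R φ ψ *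
            (y * hit R Step.south (fun χ => t * stepWeight x y χ) m ψ) := by
        intro y
        simp only [Finset.mul_sum]
        exact Finset.sum_congr rfl fun ψ _ => by ring
      rw [hsum, hsum]
      refine mul_le_mul (mul_le_mul_of_nonneg_left hs ht.le) (Finset.sum_le_sum fun ψ _ =>
        mul_le_mul_of_nonneg_left (ih ψ) (ruleInd_nonneg R φ ψ)) (Finset.sum_nonneg fun ψ _ =>
        mul_nonneg (ruleInd_nonneg R φ ψ) (mul_nonneg h₁.le (hit_nonneg R _ (fun χ => ?_) m ψ))) ?_
      · exact (mul_pos ht (stepWeight_pos hx h₁ χ)).le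
      · exact (mul_pos ht (stepWeight_pos hx h₂ φ)).le

/-- The initial north step already cancels the final south step. The factor `y` of
`mul_hit_south_mono` is then to spare, which yields the strict inequality in `numerator_pos`. -/
theorem hit_south_north_mono (R : Rule) {x y₁ y₂ t : ℝ} (hx : 0 < x) (h₁ : 0 < y₁) (h : y₁ ≤ y₂)
    (ht : 0 < t) (m : ℕ) :
    hit R Step.south (fun χ => t * stepWeight x y₁ χ) m Step.north
      ≤ hit R Step.south (fun χ => t * stepWeight x y₂ χ) m Step.north := by
  cases m with
  | zero => simp [hit]
  | succ m =>
    have hN : ∀ y : ℝ, stepWeight x y Step.north = y := fun y => by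
      simp [stepWeight, Step.dx, Step.dy]
    simp only [hit, reduceCtorEq, if_false, hN, mul_assoc]
    refine mul_le_mul_of_nonneg_left ?_ ht.le
    simp only [Finset.mul_sum]
    refine Finset.sum_le_sum fun ψ _ => ?_
    have := mul_le_mul_of_nonneg_left (mul_hit_south_mono R hx h₁ h ht m ψ)
      (ruleInd_nonneg R Step.north ψ)
    linarith

/-- The numerator of `c⁺` is positive. -/
theorem numerator_pos {R : Rule} (hR : Aperiodic R) {x τ y : ℝ} (hx : 0 < x) (hτ : 0 < τ)
    (hτy : τ < y) (hρ : rho R x y < rho R x τ) (θ : Step) :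
    0 < ∑ φ, (if φ ≠ Step.south then 1 else 0)
          * hitSum R θ (fun χ => rho R x y * stepWeight x y χ) φ
        - hitSum R θ (fun χ => rho R x y * stepWeight x y χ) Step.south
          * gf (classHstar R) (rho R x y) x 0 := by
  have hy : 0 < y := hτ.trans hτy
  obtain ⟨u, hu⟩ := exists_isPerron_rho hR hx hy
  obtain ⟨uτ, huτ⟩ := exists_isPerron_rho hR hx hτ
  have hs := stepWeight_pos hx hy
  have hsτ := stepWeight_pos hx hτ
  set ρ := rho R x y
  have hρ0 : 0 < ρ := hu.ρ_pos
  set G := gf (classHstar R) ρ x 0 with hG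
  set S := Step.south
  obtain ⟨vτ, κτ, hcτ⟩ := huτ.exists_contracts hR hsτ S
  obtain ⟨v, κ, hc⟩ := hu.exists_contracts hR hs S
  have hsumτ : ∀ φ, Summable fun m => hit R S (fun χ => ρ * stepWeight x τ χ) m φ :=
    hcτ.summable_hit fun φ => by
      rw [Real.norm_of_nonneg (mul_pos hρ0 (hsτ φ)).le]
      exact mul_le_mul_of_nonneg_right hρ.le (hsτ φ).le
  have hsumy : ∀ φ, Summable fun m => hit R S (fun χ => ρ * stepWeight x y χ) m φ :=
    hc.summable_hit fun φ => (Real.norm_of_nonneg (mul_pos hρ0 (hs φ)).le).le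
  set Fτ := hitSum R S (fun χ => ρ * stepWeight x τ χ)
  set F := hitSum R S (fun χ => ρ * stepWeight x y χ) with hF
  have hFτ0 : ∀ φ, 0 ≤ Fτ φ := fun φ =>
    tsum_nonneg fun m => hit_nonneg R S (fun χ => (mul_pos hρ0 (hsτ χ)).le) m φ
  have hFS : Fτ S = ρ * τ⁻¹ := by
    rw [show Fτ S = _ from hitSum_eq R S hsumτ S]
    simp [S, stepWeight, Step.dx, Step.dy]
  -- At height weight `τ` the value `ρ = ρ(x, y)` lies below `ρ(x, τ)`, so `1 - B > 0` and the
  -- kernel equation for south has a nonnegative left side.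
  have hker : Fτ S * G ≤ ∑ φ, (if φ ≠ S then 1 else 0) * Fτ φ := by
    have h1 := classH_kernel_equation (𝕜 := ℝ) R S hx hτ ρ hsumτ
      (summable_classH hR hx hτ hρ0.le hρ) (summable_classHstar_axis hR hx hτ hρ0.le hρ)
    have h2 : (returnSum R S fun χ => ρ * stepWeight x τ χ) < 1 := by
      have h3 := (gf_classB_lt_one hR hx hτ S hρ0.le hρ).2
      rwa [gf, (hasSum_classB hcτ hx hτ fun φ => ?_).tsum_eq] at h3
      rw [Real.norm_of_nonneg (mul_pos hρ0 (hsτ φ)).le]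
      exact mul_le_mul_of_nonneg_right hρ.le (hsτ φ).le
    have h4 : 0 ≤ (∑' m, partitionFn (classH R S) m x τ * ρ ^ m)
        * (1 - returnSum R S fun χ => ρ * stepWeight x τ χ) :=
      mul_nonneg (tsum_nonneg fun m => mul_nonneg (partitionFn_nonneg _ m hx.le hτ.le)
        (pow_pos hρ0 m).le) (sub_nonneg.2 h2.le)
    have h5 := h4.trans_eq h1
    exact sub_nonneg.1 h5
  have hmono : ∀ φ, τ * Fτ φ ≤ y * F φ := by
    intro φ
    simp only [Fτ, hF, hitSum, ← tsum_mul_left]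
    exact ((hsumτ φ).mul_left _).tsum_le_tsum
      (fun m => mul_hit_south_mono R hx hτ hτy.le hρ0 m φ) ((hsumy φ).mul_left _)
  have hFeq : ∀ φ, F φ = ρ * stepWeight x y S / u S * u φ := hu.hitSum_eq hR hs S
  have hFpos : ∀ φ, 0 < F φ := fun φ => by
    rw [hFeq]
    exact mul_pos (div_pos (mul_pos hρ0 (hs S)) (hu.u_pos S)) (hu.u_pos φ)
  have hstrict : τ * Fτ Step.north < y * F Step.north := by
    have h1 : Fτ Step.north ≤ F Step.north := (hsumτ Step.north).tsum_le_tsum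
      (fun m => hit_south_north_mono R hx hτ hτy.le hρ0 m) (hsumy Step.north)
    calc τ * Fτ Step.north ≤ τ * F Step.north := mul_le_mul_of_nonneg_left h1 hτ.le
      _ < y * F Step.north := mul_lt_mul_of_pos_right hτy (hFpos _)
  have hsumlt : τ * ∑ φ, (if φ ≠ S then 1 else 0) * Fτ φ
      < y * ∑ φ, (if φ ≠ S then 1 else 0) * F φ := by
    rw [Finset.mul_sum, Finset.mul_sum]
    refine Finset.sum_lt_sum (fun φ _ => ?_) ⟨Step.north, Finset.mem_univ _, ?_⟩
    · split_ifs
      · simpa using hmono φ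
      · simp
    · simpa [S] using hstrict
  have hSu : stepWeight x y S = y⁻¹ := by simp [S, stepWeight, Step.dx, Step.dy]
  -- As `Fτ S = ρ / τ`, the bound reads `ρ G ≤ τ C(τ) < y C(y)`, where `C` is the sum of the hitting
  -- series not starting with south. Expressing `C(y)` through `u` frees the inequality of `θ`,
  -- since every `θ` has hitting series proportional to `u`.
  have hmain : u S * G < ∑ φ, (if φ ≠ S then 1 else 0) * u φ := by
    have h1 : ρ * G ≤ τ * ∑ φ, (if φ ≠ S then 1 else 0) * Fτ φ := by
      have := mul_le_mul_of_nonneg_left hker hτ.le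
      rw [hFS] at this
      calc ρ * G = τ * (ρ * τ⁻¹ * G) := by field_simp
        _ ≤ _ := this
    have h2 : y * ∑ φ, (if φ ≠ S then 1 else 0) * F φ
        = ρ / u S * ∑ φ, (if φ ≠ S then 1 else 0) * u φ := by
      simp only [hFeq, hSu, Finset.mul_sum]
      refine Finset.sum_congr rfl fun φ _ => ?_
      field_simp
    have h3 := h1.trans_lt (h2 ▸ hsumlt)
    rw [div_mul_eq_mul_div, lt_div_iff₀ (hu.u_pos S), mul_assoc] at h3
    have h4 := lt_of_mul_lt_mul_left h3 hρ0.le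
    linarith
  simp only [hu.hitSum_eq hR hs θ]
  have hfac : 0 < ρ * stepWeight x y θ / u θ := div_pos (mul_pos hρ0 (hs θ)) (hu.u_pos θ)
  have : ∑ φ, (if φ ≠ S then 1 else 0) * (ρ * stepWeight x y θ / u θ * u φ)
      - ρ * stepWeight x y θ / u θ * u S * G
      = ρ * stepWeight x y θ / u θ * (∑ φ, (if φ ≠ S then 1 else 0) * u φ - u S * G) := by
    rw [mul_sub, Finset.mul_sum]
    congr 1
    · exact Finset.sum_congr rfl fun φ _ => by ring
    · ring
  rw [this]
  exact mul_pos hfac (sub_pos.2 hmain)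

/-! ### Coefficient asymptotics at a dominant simple pole -/

theorem coeff_eq_of_hasSum {b b' : ℕ → ℂ} {e : ℂ → ℂ} {p : ℝ} (hp : 0 < p)
    (h : ∀ t : ℂ, ‖t‖ < p → HasSum (fun m => b m * t ^ m) (e t))
    (h' : ∀ t : ℂ, ‖t‖ < p → HasSum (fun m => b' m * t ^ m) (e t)) : b = b' := by
  have key : ∀ b : ℕ → ℂ, (∀ t : ℂ, ‖t‖ < p → HasSum (fun m => b m * t ^ m) (e t)) →
      HasFPowerSeriesAt e (FormalMultilinearSeries.ofScalars ℂ b) 0 := by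
    intro b hb
    rw [hasFPowerSeriesAt_iff]
    filter_upwards [Metric.ball_mem_nhds (0 : ℂ) hp] with t ht
    have := hb t (by simpa using ht)
    simpa [FormalMultilinearSeries.coeff_ofScalars, mul_comm] using this
  have := (key b h).eq_formalMultilinearSeries (key b' h')
  ext m
  have h2 := congrArg (fun q => FormalMultilinearSeries.coeff q m) this
  simpa [FormalMultilinearSeries.coeff_ofScalars] using h2

/-- The Taylor series of `e` converges on the larger disc, in particular at `p`, and by uniqueness
its coefficients are `b`. -/
theorem tendsto_coeff_mul_pow_zero {b : ℕ → ℂ} {e : ℂ → ℂ} {p r : ℝ} (hp : 0 < p) (hr : p < r)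
    (he : DifferentiableOn ℂ e (Metric.ball 0 r))
    (h : ∀ t : ℂ, ‖t‖ < p → HasSum (fun m => b m * t ^ m) (e t)) :
    Tendsto (fun m => b m * (p : ℂ) ^ m) atTop (𝓝 0) := by
  have h1 : ∀ t : ℂ, ‖t‖ < r →
      HasSum (fun m => ((m.factorial : ℂ)⁻¹ * iteratedDeriv m e 0) * t ^ m) (e t) := by
    intro t ht
    have := Complex.hasSum_taylorSeries_on_ball he (z := t) (by simpa using ht)
    simp only [sub_zero, smul_eq_mul] at this
    refine this.congr_fun ?_
    intro m
    ring
  have h2 := coeff_eq_of_hasSum hp h fun t ht => h1 t (ht.trans hr)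
  rw [h2]
  have hpn : ‖(p : ℂ)‖ < r := by rwa [Complex.norm_real, Real.norm_of_nonneg hp.le]
  exact (h1 p hpn).summable.tendsto_atTop_zero

theorem isEquivalent_coeff_of_simple_pole {a : ℕ → ℝ} {p r c : ℝ} (hp : 0 < p) (hpr : p < r)
    (hc0 : 0 < c) {G : ℂ → ℂ} (hGd : DifferentiableOn ℂ G (Metric.ball 0 r))
    (hcG : G p = -((c : ℂ) * p))
    (hsum : ∀ t : ℂ, ‖t‖ < p → HasSum (fun m => (a m : ℂ) * t ^ m) ((t - p)⁻¹ * G t)) :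
    a ~[atTop] fun m => c * (1 / p) ^ m := by
  have hpC : (p : ℂ) ≠ 0 := Complex.ofReal_ne_zero.2 hp.ne'
  have hpnorm : ‖(p : ℂ)‖ = p := by rw [Complex.norm_real, Real.norm_of_nonneg hp.le]
  have hmem : (p : ℂ) ∈ Metric.ball (0 : ℂ) r := by simpa [abs_of_pos hp] using hpr
  -- `dslope G p` is what remains after removing the pole; its coefficients are `a m - c * p⁻¹ ^ m`.
  have hed : DifferentiableOn ℂ (dslope G (p : ℂ)) (Metric.ball 0 r) :=
    (Complex.differentiableOn_dslope (Metric.isOpen_ball.mem_nhds hmem)).2 hGd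
  have hesum : ∀ t : ℂ, ‖t‖ < p →
      HasSum (fun m => ((a m : ℂ) - c * ((p : ℂ)⁻¹) ^ m) * t ^ m) (dslope G (p : ℂ) t) := by
    intro t ht
    have hne : t - p ≠ 0 := by
      intro h
      rw [sub_eq_zero.1 h, hpnorm] at ht
      exact lt_irrefl _ ht
    have hgeo : HasSum (fun m => (c : ℂ) * ((p : ℂ)⁻¹ * t) ^ m) (c * (1 - (p : ℂ)⁻¹ * t)⁻¹) := by
      have hlt : ‖(p : ℂ)⁻¹ * t‖ < 1 := by
        rw [norm_mul, norm_inv, hpnorm, inv_mul_lt_iff₀ hp, mul_one]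
        exact ht
      exact (hasSum_geometric_of_norm_lt_one hlt).mul_left (c : ℂ)
    have h1 := (hsum t ht).sub hgeo
    have h2 : (t - p)⁻¹ * G t - c * (1 - (p : ℂ)⁻¹ * t)⁻¹ = dslope G (p : ℂ) t := by
      have h3 := sub_smul_dslope G (p : ℂ) t
      rw [hcG, smul_eq_mul, sub_neg_eq_add] at h3
      have h4 : 1 - (p : ℂ)⁻¹ * t = -((t - p) * (p : ℂ)⁻¹) := by
        rw [sub_mul, mul_inv_cancel₀ hpC]
        ring
      have h5 : G t = (t - p) * dslope G (p : ℂ) t - c * p := by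
        rw [h3]
        ring
      rw [h4, h5, inv_neg, mul_inv, inv_inv, mul_sub, inv_mul_cancel_left₀ hne]
      ring
    rw [h2] at h1
    have h6 : (fun m => ((a m : ℂ) - c * ((p : ℂ)⁻¹) ^ m) * t ^ m)
        = fun m => (a m : ℂ) * t ^ m - (c : ℂ) * ((p : ℂ)⁻¹ * t) ^ m := by
      ext m
      rw [mul_pow]
      ring
    rw [h6]
    exact h1
  have hlim := tendsto_coeff_mul_pow_zero hp hpr hed hesum
  have hlimR : Tendsto (fun m => (a m - c * (p⁻¹) ^ m) * p ^ m) atTop (𝓝 0) := by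
    have h1 := (Complex.continuous_re.tendsto 0).comp hlim
    rw [Complex.zero_re] at h1
    refine h1.congr fun m => ?_
    have : ((a m : ℂ) - c * ((p : ℂ)⁻¹) ^ m) * (p : ℂ) ^ m
        = (((a m - c * (p⁻¹) ^ m) * p ^ m : ℝ) : ℂ) := by push_cast; rfl
    rw [Function.comp_apply, this, Complex.ofReal_re]
  refine isEquivalent_of_tendsto_one ?_
  have h1 : Tendsto (fun m => 1 + (a m - c * (p⁻¹) ^ m) * p ^ m / c) atTop (𝓝 1) := by
    simpa using (hlimR.div_const c).const_add 1
  refine h1.congr fun m => ?_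
  have hpm : p ^ m ≠ 0 := (pow_pos hp m).ne'
  simp only [Pi.div_apply, one_div, inv_pow]
  field_simp
  ring

/-- Factor the simple zero out of `den`. The continuation is `(t - p)⁻¹ * (num / q)` with `q p =
-d`, so near `p` it behaves like `(n / d) / (p - t)`, which gives the constant `n / (p * d)`. -/
theorem hasDominantSimplePole_of_kernel {a : ℕ → ℝ} {p d n r₀ : ℝ} (hp : 0 < p) (hr₀ : p < r₀)
    (hd : 0 < d) (hn : 0 < n) {num den : ℂ → ℂ}
    (hnum : DifferentiableOn ℂ num (Metric.ball 0 r₀))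
    (hden : DifferentiableOn ℂ den (Metric.ball 0 r₀))
    (hzero : ∀ t : ℂ, ‖t‖ ≤ p → den t = 0 → t = p) (hdenp : den p = 0)
    (hderiv : HasDerivAt den (-(d : ℂ)) (p : ℂ)) (hnump : num p = (n : ℂ))
    (hsum : ∀ t : ℂ, ‖t‖ < p → Summable fun m => (a m : ℂ) * t ^ m)
    (hker : ∀ t : ℂ, ‖t‖ < p → (∑' m, (a m : ℂ) * t ^ m) * den t = num t) :
    HasDominantSimplePole a p (n / (p * d)) ∧
      a ~[atTop] fun m => n / (p * d) * (1 / p) ^ m := by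
  have hpC : (p : ℂ) ≠ 0 := Complex.ofReal_ne_zero.2 hp.ne'
  have hdC : (d : ℂ) ≠ 0 := Complex.ofReal_ne_zero.2 hd.ne'
  have hnC : (n : ℂ) ≠ 0 := Complex.ofReal_ne_zero.2 hn.ne'
  have hpnorm : ‖(p : ℂ)‖ = p := by rw [Complex.norm_real, Real.norm_of_nonneg hp.le]
  have hmem : ∀ {r : ℝ}, p < r → (p : ℂ) ∈ Metric.ball (0 : ℂ) r := fun h => by
    simpa [abs_of_pos hp] using h
  set q := dslope den (p : ℂ) with hq
  have hqd : DifferentiableOn ℂ q (Metric.ball 0 r₀) :=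
    (Complex.differentiableOn_dslope (Metric.isOpen_ball.mem_nhds (hmem hr₀))).2 hden
  have hqp : q p = -(d : ℂ) := by rw [hq, dslope_same, hderiv.deriv]
  have hfac : ∀ t, den t = (t - p) * q t := by
    intro t
    have := sub_smul_dslope den (p : ℂ) t
    rw [hdenp, sub_zero, smul_eq_mul] at this
    exact this.symm
  have hq0 : ∀ t : ℂ, ‖t‖ ≤ p → q t ≠ 0 := by
    intro t ht h0
    by_cases htp : t = p
    · rw [htp, hqp] at h0
      exact hdC (neg_eq_zero.1 h0)
    · exact htp (hzero t ht (by rw [hfac, h0, mul_zero]))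
  -- The quotient `q` has no zero on the compact closed disc of radius `p`, hence none on a slightly
  -- larger open disc.
  obtain ⟨r, hpr, hrr, hqr⟩ : ∃ r, p < r ∧ Metric.ball (0 : ℂ) r ⊆ Metric.ball 0 r₀ ∧
      ∀ t ∈ Metric.ball (0 : ℂ) r, q t ≠ 0 := by
    have hV : IsOpen (Metric.ball (0 : ℂ) r₀ ∩ q ⁻¹' {0}ᶜ) :=
      hqd.continuousOn.isOpen_inter_preimage Metric.isOpen_ball isOpen_compl_singleton
    have hsub : Metric.closedBall (0 : ℂ) p ⊆ Metric.ball (0 : ℂ) r₀ ∩ q ⁻¹' {0}ᶜ := by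
      intro t ht
      have ht' : ‖t‖ ≤ p := by simpa using ht
      exact ⟨by simpa using ht'.trans_lt hr₀, hq0 t ht'⟩
    obtain ⟨δ, hδ, hsubδ⟩ := (isCompact_closedBall (0 : ℂ) p).exists_thickening_subset_open hV hsub
    rw [thickening_closedBall hδ hp.le] at hsubδ
    exact ⟨δ + p, by linarith, fun t ht => (hsubδ ht).1, fun t ht => (hsubδ ht).2⟩
  set G : ℂ → ℂ := fun t => num t / q t with hG
  have hGd : DifferentiableOn ℂ G (Metric.ball 0 r) :=
    (hnum.mono hrr).div (hqd.mono hrr) hqr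
  have hGp : G p = -((n : ℂ) / d) := by
    simp only [hG, hqp, hnump]
    rw [div_neg]
  have hGan : AnalyticAt ℂ G p := hGd.analyticAt (Metric.isOpen_ball.mem_nhds (hmem hpr))
  set f : ℂ → ℂ := fun t => (t - p)⁻¹ * G t with hf
  have hfsum : ∀ t : ℂ, ‖t‖ < p → HasSum (fun m => (a m : ℂ) * t ^ m) (f t) := by
    intro t ht
    have hne : t - p ≠ 0 := by
      intro h
      rw [sub_eq_zero.1 h, hpnorm] at ht
      exact lt_irrefl _ ht
    have hq1 := hq0 t ht.le
    have : f t = ∑' m, (a m : ℂ) * t ^ m := by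
      have h1 := hker t ht
      rw [hfac] at h1
      simp only [hf, hG]
      rw [← h1]
      field_simp
    rw [this]
    exact (hsum t ht).hasSum
  set c : ℝ := n / (p * d) with hc
  have hc0 : 0 < c := div_pos hn (mul_pos hp hd)
  have hcC : (c : ℂ) ≠ 0 := Complex.ofReal_ne_zero.2 hc0.ne'
  have hcG : G p = -((c : ℂ) * p) := by
    rw [hGp, hc]
    push_cast
    field_simp
  refine ⟨⟨hp, r, hpr, f, hfsum, ?_, ?_, ?_⟩, ?_⟩
  · refine DifferentiableOn.analyticOnNhd ?_ (Metric.isOpen_ball.sdiff isClosed_singleton)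
    refine DifferentiableOn.mul (DifferentiableOn.inv (by fun_prop) ?_)
      (hGd.mono Set.sdiff_subset)
    intro t ht
    exact sub_ne_zero.2 ht.2
  · have hmer : MeromorphicAt f (p : ℂ) := by
      refine MeromorphicAt.mul (MeromorphicAt.inv ?_) hGan.meromorphicAt
      exact AnalyticAt.meromorphicAt (by fun_prop)
    have := (meromorphicOrderAt_eq_int_iff (n := -1) hmer).2 ⟨G, hGan, ?_, ?_⟩
    · exact this
    · rw [hcG]
      exact neg_ne_zero.2 (mul_ne_zero hcC hpC)
    · exact Eventually.of_forall fun t => by simp [hf]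
  · refine isEquivalent_of_tendsto_one ?_
    have h1 : Tendsto (fun t => -G t / ((c : ℂ) * p)) (𝓝[≠] (p : ℂ)) (𝓝 1) := by
      have h2 : Tendsto (fun t => -G t / ((c : ℂ) * p)) (𝓝[≠] (p : ℂ))
          (𝓝 (-G p / ((c : ℂ) * p))) :=
        ((hGan.continuousAt.tendsto.mono_left nhdsWithin_le_nhds).neg).div_const _
      rwa [hcG, neg_neg, div_self (mul_ne_zero hcC hpC)] at h2
    refine h1.congr' ?_
    filter_upwards [self_mem_nhdsWithin] with t ht
    have ht' : t - p ≠ 0 := sub_ne_zero.2 ht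
    have ht2 : (p : ℂ) - t ≠ 0 := sub_ne_zero.2 (Ne.symm ht)
    have ht3 : 1 - t / (p : ℂ) = (p - t) / p := by field_simp
    simp only [Pi.div_apply, hf, ht3]
    field_simp
    ring
  · exact isEquivalent_coeff_of_simple_pole hp hpr hc0 hGd hcG hfsum

/-! ### The kernel has no other zero in the closed disc -/

theorem eigen_pow (A : Matrix Step Step ℝ) {t : ℂ} {F : Step → ℂ}
    (h : ∀ φ, F φ = t * ∑ ψ, (A φ ψ : ℂ) * F ψ) (n : ℕ) (φ : Step) :
    F φ = t ^ n * ∑ ψ, ((A ^ n) φ ψ : ℂ) * F ψ := by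
  induction n generalizing φ with
  | zero => simp [Matrix.one_apply, apply_ite Complex.ofReal]
  | succ n ih =>
    have h1 : ∑ χ, ((A ^ (n + 1)) φ χ : ℂ) * F χ
        = ∑ ψ, ((A ^ n) φ ψ : ℂ) * ∑ χ, (A ψ χ : ℂ) * F χ := by
      simp only [pow_succ, Matrix.mul_apply, Complex.ofReal_sum, Complex.ofReal_mul,
        Finset.sum_mul, Finset.mul_sum]
      rw [Finset.sum_comm]
      exact Finset.sum_congr rfl fun ψ _ => Finset.sum_congr rfl fun χ _ => by ring
    rw [ih φ, h1, pow_succ, mul_assoc, Finset.mul_sum (a := t)]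
    congr 1
    refine Finset.sum_congr rfl fun ψ _ => ?_
    conv_lhs => rw [h ψ]
    ring

/-- Equality case of the triangle inequality: since `F` is dominated by `U` and has the same modulus
at `θ`, every term of the expansion of `F θ` by `A ^ n` with nonzero coefficient has the phase of `F
θ`. The diagonal term compares `t ^ n * F θ` with `F θ`. -/
theorem pow_eq_of_dominated_eigenvector (A : Matrix Step Step ℝ) (hA : ∀ φ ψ, 0 ≤ A φ ψ) {t : ℂ}
    {ρ : ℝ} (hρ : 0 < ρ) (ht : ‖t‖ = ρ) {F : Step → ℂ} {U : Step → ℝ} (hU : ∀ φ, 0 < U φ)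
    (hF : ∀ φ, F φ = t * ∑ ψ, (A φ ψ : ℂ) * F ψ) (hUe : ∀ φ, U φ = ρ * ∑ ψ, A φ ψ * U ψ)
    (hle : ∀ φ, ‖F φ‖ ≤ U φ) {θ : Step} (hθ : ‖F θ‖ = U θ) {n : ℕ} (hn : 0 < (A ^ n) θ θ) :
    t ^ n = (ρ : ℂ) ^ n := by
  have hUn : U θ = ρ ^ n * ∑ ψ, (A ^ n) θ ψ * U ψ := by
    have := eigen_pow A (t := (ρ : ℂ)) (F := fun φ => (U φ : ℂ)) (fun φ => by
      rw [hUe φ]; push_cast; rfl) n θ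
    exact_mod_cast this
  have hFn := eigen_pow A hF n θ
  set z : Step → ℂ := fun ψ => (starRingEnd ℂ) (F θ) * (t ^ n * F ψ) with hz
  have hznorm : ∀ ψ, (z ψ).re ≤ U θ * (ρ ^ n * U ψ) := by
    intro ψ
    refine (Complex.re_le_norm _).trans ?_
    rw [hz]
    simp only [norm_mul, norm_pow, RCLike.norm_conj, ht, hθ]
    exact mul_le_mul_of_nonneg_left (mul_le_mul_of_nonneg_left (hle ψ) (pow_pos hρ n).le)
      (hU θ).le
  have hzsum : ∑ ψ, (A ^ n) θ ψ * (U θ * (ρ ^ n * U ψ) - (z ψ).re) = 0 := by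
    have h1 : ∑ ψ, ((A ^ n) θ ψ : ℂ) * z ψ = ((U θ * U θ : ℝ) : ℂ) := by
      have h2 : ∑ ψ, ((A ^ n) θ ψ : ℂ) * z ψ = (starRingEnd ℂ) (F θ) * F θ := by
        nth_rw 2 [hFn]
        simp only [hz, Finset.mul_sum]
        exact Finset.sum_congr rfl fun ψ _ => by ring
      rw [h2, mul_comm, Complex.mul_conj, Complex.normSq_eq_norm_sq, hθ, sq]
    have h3 : ∑ ψ, (A ^ n) θ ψ * (z ψ).re = U θ * U θ := by
      have := congrArg Complex.re h1
      rw [Complex.re_sum, Complex.ofReal_re] at this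
      simpa only [Complex.re_ofReal_mul] using this
    simp only [mul_sub, Finset.sum_sub_distrib, h3]
    nth_rw 3 [hUn]
    simp only [Finset.mul_sum]
    rw [sub_eq_zero]
    exact Finset.sum_congr rfl fun ψ _ => by ring
  have hterm := (Finset.sum_eq_zero_iff_of_nonneg fun ψ _ => mul_nonneg
    (matrix_pow_nonneg hA n θ ψ) (sub_nonneg.2 (hznorm ψ))).1 hzsum θ (Finset.mem_univ θ)
  have hre : (z θ).re = U θ * (ρ ^ n * U θ) :=
    (sub_eq_zero.1 ((mul_eq_zero.1 hterm).resolve_left hn.ne')).symm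
  have hzθ : z θ = ((U θ * U θ : ℝ) : ℂ) * t ^ n := by
    have : (starRingEnd ℂ) (F θ) * F θ = ((U θ * U θ : ℝ) : ℂ) := by
      rw [mul_comm, Complex.mul_conj, Complex.normSq_eq_norm_sq, hθ, sq]
    rw [← this, hz]
    ring
  rw [hzθ, Complex.re_ofReal_mul] at hre
  have hre2 : (t ^ n).re = ρ ^ n := by
    have h0 : U θ * U θ ≠ 0 := (mul_pos (hU θ) (hU θ)).ne'
    refine mul_left_cancel₀ h0 ?_
    rw [hre]
    ring
  have hnorm : ‖t ^ n‖ = ρ ^ n := by rw [norm_pow, ht]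
  have h5 := (Complex.re_eq_norm.1 (hre2.trans hnorm.symm))
  rw [← Complex.ofReal_pow, ← hnorm]
  exact (Complex.eq_coe_norm_of_nonneg h5)

theorem norm_ofReal_weight_le {x y : ℝ} (hx : 0 < x) (hy : 0 < y) {t : ℂ} {b : ℝ} (ht : ‖t‖ ≤ b)
    (φ : Step) : ‖t * ((stepWeight x y φ : ℝ) : ℂ)‖ ≤ b * stepWeight x y φ := by
  have hs := stepWeight_pos hx hy φ
  rw [norm_mul, Complex.norm_real, Real.norm_of_nonneg hs.le]
  exact mul_le_mul_of_nonneg_right ht hs.le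

theorem norm_hitSum_le {R : Rule} {θ : Step} {x y b : ℝ} (hx : 0 < x) (hy : 0 < y)
    {v : Step → ℝ} {κ : ℝ} (hc : Contracts R θ (fun φ => b * stepWeight x y φ) v κ) {t : ℂ}
    (ht : ‖t‖ ≤ b) (φ : Step) :
    ‖hitSum R θ (fun χ => t * ((stepWeight x y χ : ℝ) : ℂ)) φ‖
      ≤ hitSum R θ (fun χ => ‖t‖ * stepWeight x y χ) φ := by
  have hs := stepWeight_pos hx hy
  have hterm : ∀ m, ‖hit R θ (fun χ => t * ((stepWeight x y χ : ℝ) : ℂ)) m φ‖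
      = hit R θ (fun χ => ‖t‖ * stepWeight x y χ) m φ := by
    intro m
    have h1 := map_hit Complex.ofRealHom R θ (stepWeight x y) m φ
    simp only [Complex.ofRealHom_eq_coe] at h1
    rw [hit_smul, hit_smul, norm_mul, norm_pow, ← h1, Complex.norm_real,
      Real.norm_of_nonneg (hit_nonneg R θ (fun χ => (hs χ).le) m φ)]
  have hsum : Summable fun m => hit R θ (fun χ => ‖t‖ * stepWeight x y χ) m φ :=
    hc.summable_hit (fun χ => by
      rw [Real.norm_of_nonneg (mul_nonneg (norm_nonneg t) (hs χ).le)]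
      exact mul_le_mul_of_nonneg_right ht (hs χ).le) φ
  simp only [← hterm] at hsum
  simp only [hitSum, ← hterm]
  exact norm_tsum_le_tsum_norm hsum

/-- Domination by the positive series excludes `‖t‖ < ρ`. On the circle, `B_θ(t) = 1` supplies the
missing row `θ`, so the hitting series form an eigenvector dominated by the Perron one. Two
consecutive powers with positive diagonal entry then force `t = ρ`. -/
theorem eq_rho_of_returnSum_eq_one {R : Rule} (hR : Aperiodic R) {x y : ℝ} (hx : 0 < x)
    (hy : 0 < y) (θ : Step) {t : ℂ} (ht : ‖t‖ ≤ rho R x y)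
    (h : returnSum R θ (fun χ => t * ((stepWeight x y χ : ℝ) : ℂ)) = 1) : t = rho R x y := by
  obtain ⟨u, hu⟩ := exists_isPerron_rho hR hx hy
  have hs := stepWeight_pos hx hy
  obtain ⟨v, κ, hc⟩ := hu.exists_contracts hR hs θ
  have hρ := hu.ρ_pos
  have hle := norm_hitSum_le hx hy hc ht
  have hnorm : ‖t‖ = rho R x y := by
    refine le_antisymm ht (not_lt.1 fun hlt => ?_)
    have h1 := (gf_classB_lt_one hR hx hy θ (norm_nonneg t) hlt).2
    rw [gf, (hasSum_classB hc hx hy fun φ => by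
      rw [Real.norm_of_nonneg (mul_nonneg (norm_nonneg t) (hs φ).le)]
      exact mul_le_mul_of_nonneg_right ht (hs φ).le).tsum_eq] at h1
    have h2 : (1 : ℝ) ≤ returnSum R θ fun χ => ‖t‖ * stepWeight x y χ := by
      rw [← norm_one (α := ℂ), ← h, returnSum]
      refine (norm_sum_le _ _).trans (Finset.sum_le_sum fun φ _ => ?_)
      rw [norm_ruleInd_mul]
      exact mul_le_mul_of_nonneg_left (hle φ) (ruleInd_nonneg R θ φ)
    exact absurd h1 (not_lt.2 h2)
  set F := hitSum R θ (fun χ => t * ((stepWeight x y χ : ℝ) : ℂ)) with hF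
  set U := hitSum R θ (fun χ => rho R x y * stepWeight x y χ) with hU
  rw [hnorm] at hle
  have hUpos : ∀ φ, 0 < U φ := fun φ => by
    rw [hU, hu.hitSum_eq hR hs]
    exact mul_pos (div_pos (mul_pos hρ (hs θ)) (hu.u_pos θ)) (hu.u_pos φ)
  set A := weightedTransfer R (stepWeight x y) with hA
  have hFeq : ∀ φ, F φ = t * ∑ ψ, (A φ ψ : ℂ) * F ψ := by
    intro φ
    have h1 : F φ = t * ((stepWeight x y φ : ℝ) : ℂ) * ∑ ψ, ruleInd R φ ψ * F ψ := by
      rw [hF, hitSum_eq R θ (hc.summable_hit (norm_ofReal_weight_le hx hy ht)) φ, ← hF]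
      split_ifs with hφ
      · rw [hφ]
        rw [returnSum] at h
        rw [h]
      · rfl
    rw [h1, mul_assoc, Finset.mul_sum]
    congr 1
    refine Finset.sum_congr rfl fun ψ _ => ?_
    simp only [hA, weightedTransfer, Matrix.of_apply, Complex.ofReal_mul, ofReal_ruleInd]
    ring
  have hUeq : ∀ φ, U φ = rho R x y * ∑ ψ, A φ ψ * U ψ := by
    intro φ
    have h1 := hu.eq φ
    simp only [hU, hu.hitSum_eq hR hs, hA, weightedTransfer, Matrix.of_apply]
    rw [h1]
    simp only [Finset.mul_sum]
    exact Finset.sum_congr rfl fun ψ _ => by ring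
  have hθ : ‖F θ‖ = U θ := by
    rw [hF, hitSum_eq R θ (hc.summable_hit (norm_ofReal_weight_le hx hy ht)) θ, hU,
      hitSum_eq R θ (hc.summable_hit fun φ => (Real.norm_of_nonneg (mul_pos hρ (hs φ)).le).le) θ]
    simp only [if_true, mul_one]
    rw [norm_mul, hnorm, Complex.norm_real, Real.norm_of_nonneg (hs θ).le]
  have hA0 : ∀ φ ψ, 0 ≤ A φ ψ := weightedTransfer_nonneg R hs
  obtain ⟨k, -, hk⟩ := hR
  have hAk : ∀ φ ψ, 0 < (A ^ k) φ ψ := fun φ ψ => weightedTransfer_pow_pos R hs k φ ψ (hk φ ψ)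
  have hAk1 : 0 < (A ^ (k + 1)) θ θ := by
    rw [pow_succ', Matrix.mul_apply]
    have h1 : 0 < ∑ ψ, A θ ψ * U ψ := pos_of_mul_pos_right (hUeq θ ▸ hUpos θ) hρ.le
    obtain ⟨ψ, -, hψ⟩ := Finset.exists_lt_of_sum_lt
      (show ∑ ψ : Step, (0 : ℝ) < ∑ ψ, A θ ψ * U ψ by simpa using h1)
    exact Finset.sum_pos' (fun χ _ => mul_nonneg (hA0 θ χ) (hAk χ θ).le)
      ⟨ψ, Finset.mem_univ ψ, mul_pos (pos_of_mul_pos_left hψ (hUpos ψ).le) (hAk ψ θ)⟩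
  have e1 := pow_eq_of_dominated_eigenvector A hA0 hρ hnorm hUpos hFeq hUeq hle hθ (hAk θ θ)
  have e2 := pow_eq_of_dominated_eigenvector A hA0 hρ hnorm hUpos hFeq hUeq hle hθ hAk1
  rw [pow_succ, pow_succ, e1] at e2
  exact mul_left_cancel₀ (pow_ne_zero k (Complex.ofReal_ne_zero.2 hρ.ne')) e2

/-! ### The `t`-derivative of `B_θ` at `ρ`, and the pole of `H_θ`. -/

theorem gf_classB_le_div_rho {R : Rule} (hR : Aperiodic R) {x y : ℝ} (hx : 0 < x) (hy : 0 < y)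
    (θ : Step) {t : ℝ} (ht0 : 0 ≤ t) (ht : t < rho R x y) :
    gf (classB R θ) t x y ≤ t / rho R x y := by
  have hρ := rho_pos hR hx hy
  have hsum := (hasSum_classB_rho hR hx hy θ).mul_left (t / rho R x y)
  have hle : ∀ m, partitionFn (classB R θ) m x y * t ^ m
      ≤ t / rho R x y * (partitionFn (classB R θ) m x y * rho R x y ^ m) := by
    intro m
    rcases Nat.eq_zero_or_pos m with rfl | hm
    · simp [partitionFn_classB_zero R θ hx hy]
    · have h1 : (t / rho R x y) ^ m ≤ t / rho R x y :=
        pow_le_of_le_one (div_nonneg ht0 hρ.le) ((div_le_one hρ).2 ht.le) hm.ne'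
      have h2 : 0 ≤ partitionFn (classB R θ) m x y * rho R x y ^ m :=
        mul_nonneg (partitionFn_nonneg _ m hx.le hy.le) (pow_pos hρ m).le
      calc partitionFn (classB R θ) m x y * t ^ m
          = (t / rho R x y) ^ m * (partitionFn (classB R θ) m x y * rho R x y ^ m) := by
            rw [div_pow]
            have := (pow_pos hρ m).ne'
            field_simp
        _ ≤ _ := mul_le_mul_of_nonneg_right h1 h2
  have := (gf_classB_lt_one hR hx hy θ ht0 ht).1.tsum_le_tsum hle hsum.summable
  rwa [hsum.tsum_eq, mul_one] at this

/-- The graph of `B_θ` lies below the chord `t / ρ` on `[0, ρ)` and meets it at `ρ`, so the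
derivative is at least `1 / ρ`. -/
theorem dtB_pos {R : Rule} (hR : Aperiodic R) {x y : ℝ} (hx : 0 < x) (hy : 0 < y) (θ : Step)
    (hd : HasDerivAt (fun t => gf (classB R θ) t x y) (dtB R θ x y) (rho R x y)) :
    0 < dtB R θ x y := by
  have hρ := rho_pos hR hx hy
  have h1 : gf (classB R θ) (rho R x y) x y = 1 := (hasSum_classB_rho hR hx hy θ).tsum_eq
  refine (inv_pos.2 hρ).trans_le ?_
  have hslope := hd.tendsto_slope.mono_left
    (nhdsWithin_mono _ fun t (ht : t ∈ Set.Iio (rho R x y)) => ht.ne)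
  refine ge_of_tendsto hslope ?_
  filter_upwards [Ioo_mem_nhdsLT hρ] with t ht
  have h2 := gf_classB_le_div_rho hR hx hy θ ht.1.le ht.2
  rw [slope_comm, slope_def_field, h1, le_div_iff₀ (sub_pos.2 ht.2)]
  have h3 : (rho R x y)⁻¹ * (rho R x y - t) = 1 - t / rho R x y := by
    field_simp
  rw [h3]
  linarith

theorem hasDerivAt_returnSum {R : Rule} (hR : Aperiodic R) {x y : ℝ} (hx : 0 < x) (hy : 0 < y)
    (θ : Step) {c : ℝ} (hc1 : 1 < c) {v : Step → ℝ} {κ : ℝ}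
    (hc : Contracts R θ (fun φ => c * rho R x y * stepWeight x y φ) v κ) :
    HasDerivAt (fun t => gf (classB R θ) t x y) (dtB R θ x y) (rho R x y) ∧
    HasDerivAt (fun t : ℂ => returnSum R θ fun χ => t * ((stepWeight x y χ : ℝ) : ℂ))
      (dtB R θ x y : ℂ) (rho R x y : ℂ) := by
  have hρ := rho_pos hR hx hy
  have hlt : rho R x y < c * rho R x y := lt_mul_of_one_lt_left hρ hc1
  have hdiff : DifferentiableOn ℂ
      (fun t : ℂ => returnSum R θ fun χ => t * ((stepWeight x y χ : ℝ) : ℂ))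
      (Metric.ball 0 (c * rho R x y)) :=
    hc.differentiableOn_returnSum Metric.isOpen_ball (fun φ => by fun_prop) fun t ht =>
      norm_ofReal_weight_le hx hy (by simpa using (Metric.mem_ball.1 ht).le)
  have hmem : (rho R x y : ℂ) ∈ Metric.ball (0 : ℂ) (c * rho R x y) := by
    simpa [abs_of_pos hρ] using hlt
  have h1 := (hdiff.differentiableAt (Metric.isOpen_ball.mem_nhds hmem)).hasDerivAt
  have h2 := hasDerivAt_of_complex (g := fun t => gf (classB R θ) t x y) h1 ?_
  · have h3 : dtB R θ x y = _ := h2.1.deriv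
    rw [h3, ← h2.2]
    exact ⟨h2.1, h1⟩
  · filter_upwards [Ioo_mem_nhds hρ hlt] with t ht
    have h4 := hasSum_classB hc hx hy (t := t) fun φ => by
      rw [Real.norm_of_nonneg (mul_pos ht.1 (stepWeight_pos hx hy φ)).le]
      exact mul_le_mul_of_nonneg_right ht.2.le (stepWeight_pos hx hy φ).le
    rw [gf, h4.tsum_eq, ofReal_returnSum]
    simp only [Complex.ofReal_mul]

theorem Contracts.hasSum_classC {R : Rule} {θ : Step} {w v : Step → ℝ} {κ : ℝ}
    (hc : Contracts R θ w v κ) {x y t : ℝ} (hx : 0 < x) (hy : 0 < y)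
    (hw : ∀ φ, ‖t * stepWeight x y φ‖ ≤ w φ) :
    HasSum (fun m => partitionFn (classC R θ) m x y * t ^ m)
      (∑ φ, (if φ ≠ Step.south then 1 else 0)
        * hitSum R θ (fun χ => t * stepWeight x y χ) φ) := by
  simp only [partitionFn_classC R θ hx.ne' hy.ne', Finset.sum_mul, mul_assoc, ← hit_smul]
  exact hasSum_sum fun φ _ => (hasSum_hitSum hc hw φ).mul_left _

theorem Contracts.hasSum_classD {R : Rule} {θ : Step} {w v : Step → ℝ} {κ : ℝ}
    (hc : Contracts R θ w v κ) {x y t : ℝ} (hx : 0 < x) (hy : 0 < y)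
    (hw : ∀ φ, ‖t * stepWeight x y φ‖ ≤ w φ) :
    HasSum (fun m => partitionFn (classD R θ) m x y * t ^ m)
      (hitSum R θ (fun χ => t * stepWeight x y χ) Step.south) := by
  simp only [partitionFn_classD R θ hx.ne' hy.ne', ← hit_smul]
  exact hasSum_hitSum hc hw _

theorem differentiableOn_tsum_mul_pow {a : ℕ → ℝ} (ha : ∀ m, 0 ≤ a m) {r : ℝ}
    (h : ∀ t, 0 ≤ t → t < r → Summable fun m => a m * t ^ m) :
    DifferentiableOn ℂ (fun t : ℂ => ∑' m, (a m : ℂ) * t ^ m) (Metric.ball 0 r) := by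
  intro z hz
  have hz' : ‖z‖ < r := by simpa using hz
  obtain ⟨r', h1, h2⟩ := exists_between hz'
  have hd : DifferentiableOn ℂ (fun t : ℂ => ∑' m, (a m : ℂ) * t ^ m) (Metric.ball 0 r') := by
    refine Complex.differentiableOn_tsum_of_summable_norm (h r' ((norm_nonneg z).trans h1.le) h2)
      (fun m => by fun_prop) Metric.isOpen_ball fun m t ht => ?_
    rw [norm_mul, norm_pow, Complex.norm_real, Real.norm_of_nonneg (ha m)]
    have : ‖t‖ ≤ r' := by simpa using (Metric.mem_ball.1 ht).le
    exact mul_le_mul_of_nonneg_left (pow_le_pow_left₀ (norm_nonneg t) this m) (ha m)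
  exact (hd.differentiableAt (Metric.isOpen_ball.mem_nhds (by simpa using h1))).differentiableWithinAt

theorem summable_ofReal_mul_pow {a : ℕ → ℝ} (ha : ∀ m, 0 ≤ a m) {t : ℂ}
    (h : Summable fun m => a m * ‖t‖ ^ m) : Summable fun m => (a m : ℂ) * t ^ m := by
  refine Summable.of_norm ?_
  simpa only [norm_mul, norm_pow, Complex.norm_real, Real.norm_of_nonneg (ha _)] using h

theorem classH_pole_of_rho_lt {R : Rule} (hA : Aperiodic R) {x τ y : ℝ} (hx : 0 < x) (hτ : 0 < τ)
    (hτy : τ < y) (hρτ : rho R x y < rho R x τ) (θ : Step) :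
    0 < dtB R θ x y ∧
        GFConverges (classC R θ) (rho R x y) x y ∧
        GFConverges (classD R θ) (rho R x y) x y ∧
        GFConverges (classHstar R) (rho R x y) x 0 ∧
        0 < cPlus R θ x y ∧
        HasDominantSimplePole (fun m => partitionFn (classH R θ) m x y)
          (rho R x y) (cPlus R θ x y) ∧
        (fun m : ℕ => partitionFn (classH R θ) m x y)
          ~[atTop] fun m : ℕ => cPlus R θ x y * mu R x y ^ m := by
  have hy : 0 < y := hτ.trans hτy
  obtain ⟨u, hu⟩ := exists_isPerron_rho hA hx hy
  have hs := stepWeight_pos hx hy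
  have hρ := hu.ρ_pos
  obtain ⟨v, κ, hc⟩ := hu.exists_contracts hA hs θ
  obtain ⟨c, hc1, hc'⟩ := hc.exists_dilation
  simp only [← mul_assoc] at hc'
  have hw : ∀ φ, ‖rho R x y * stepWeight x y φ‖ ≤ rho R x y * stepWeight x y φ :=
    fun φ => (Real.norm_of_nonneg (mul_pos hρ (hs φ)).le).le
  have hC := hc.hasSum_classC hx hy hw
  have hD := hc.hasSum_classD hx hy hw
  have hG := summable_classHstar_axis hA hx hτ hρ.le hρτ
  obtain ⟨hdR, hdC⟩ := hasDerivAt_returnSum hA hx hy θ hc1 hc'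
  have hdpos := dtB_pos hA hx hy θ hdR
  have hnpos := numerator_pos hA hx hτ hτy hρτ θ
  have hcP : cPlus R θ x y = (∑ φ, (if φ ≠ Step.south then 1 else 0)
        * hitSum R θ (fun χ => rho R x y * stepWeight x y χ) φ
      - hitSum R θ (fun χ => rho R x y * stepWeight x y χ) Step.south
        * gf (classHstar R) (rho R x y) x 0) / (rho R x y * dtB R θ x y) := by
    rw [cPlus, ← hC.tsum_eq, ← hD.tsum_eq]
    rfl
  have hH0 : ∀ φ m, 0 ≤ partitionFn (classH R φ) m x y :=
    fun φ m => partitionFn_nonneg _ m hx.le hy.le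
  have hS0 : ∀ m, 0 ≤ partitionFn (classHstar R) m x 0 :=
    fun m => partitionFn_nonneg _ m hx.le le_rfl
  refine ⟨hdpos, hC.summable, hD.summable, hG, ?_⟩
  rw [hcP, mu]
  refine ⟨div_pos hnpos (mul_pos hρ hdpos), ?_⟩
  -- The first radius bounds the disc where the hitting series are controlled, the second the disc
  -- where H^* on the axis is. The hypothesis `hρτ` puts the pole strictly inside both.
  have hr₀ : rho R x y < min (c * rho R x y) (rho R x τ) :=
    lt_min (lt_mul_of_one_lt_left hρ hc1) hρτ
  have hball : ∀ t ∈ Metric.ball (0 : ℂ) (min (c * rho R x y) (rho R x τ)), ∀ φ,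
      ‖t * ((stepWeight x y φ : ℝ) : ℂ)‖ ≤ c * rho R x y * stepWeight x y φ := by
    intro t ht φ
    refine norm_ofReal_weight_le hx hy ?_ φ
    have : ‖t‖ < min (c * rho R x y) (rho R x τ) := by simpa using ht
    exact this.le.trans (min_le_left _ _)
  have hdhit := hc'.differentiableOn_hitSum (a := fun t χ => t * ((stepWeight x y χ : ℝ) : ℂ))
    Metric.isOpen_ball (fun φ => by fun_prop) hball
  refine hasDominantSimplePole_of_kernel hρ hr₀ hdpos hnpos
    (num := fun t => ∑ φ, (if φ ≠ Step.south then 1 else 0)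
        * hitSum R θ (fun χ => t * ((stepWeight x y χ : ℝ) : ℂ)) φ
        - hitSum R θ (fun χ => t * ((stepWeight x y χ : ℝ) : ℂ)) Step.south
          * ∑' m, ((partitionFn (classHstar R) m x 0 : ℝ) : ℂ) * t ^ m)
    (den := fun t => 1 - returnSum R θ fun χ => t * ((stepWeight x y χ : ℝ) : ℂ))
    ?_ ?_ ?_ ?_ ?_ ?_ ?_ ?_
  · refine (DifferentiableOn.fun_sum fun φ _ => (hdhit φ).const_mul _).sub
      ((hdhit Step.south).mul ?_)
    refine (differentiableOn_tsum_mul_pow hS0 fun t h0 h1 =>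
      summable_classHstar_axis hA hx hτ h0 h1).mono ?_
    exact Metric.ball_subset_ball (min_le_right _ _)
  · exact (differentiableOn_const 1).sub
      (hc'.differentiableOn_returnSum Metric.isOpen_ball (fun φ => by fun_prop) hball)
  · intro t ht h0
    exact eq_rho_of_returnSum_eq_one hA hx hy θ ht (sub_eq_zero.1 h0).symm
  · have h1 := hu.returnSum_eq_one hA hs θ
    have h2 := ofReal_returnSum R θ (fun χ => rho R x y * stepWeight x y χ)
    rw [h1] at h2
    simp only [Complex.ofReal_mul] at h2
    rw [← h2]
    simp
  · simpa using hdC.const_sub 1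
  · have h2 := ofReal_hitSum R θ (fun χ => rho R x y * stepWeight x y χ)
    simp only [Complex.ofReal_mul] at h2
    simp only [← h2, gf, Complex.ofReal_tsum, Complex.ofReal_sub, Complex.ofReal_sum,
      Complex.ofReal_mul, Complex.ofReal_pow, apply_ite Complex.ofReal, Complex.ofReal_one,
      Complex.ofReal_zero]
  · intro t ht
    exact summable_ofReal_mul_pow (hH0 θ) (summable_classH hA hx hy (norm_nonneg t) ht θ)
  · intro t ht
    exact classH_kernel_equation R θ hx hy t
      (hc.summable_hit (norm_ofReal_weight_le hx hy ht.le))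
      (fun φ => summable_ofReal_mul_pow (hH0 φ) (summable_classH hA hx hy (norm_nonneg t) ht φ))
      (summable_ofReal_mul_pow hS0
        (summable_classHstar_axis hA hx hτ (norm_nonneg t) (ht.trans hρτ)))

end

end TwoStep

open TwoStep
theorem mainTheorem3 (R : Rule) (hA : Aperiodic R) (hV : VerticallyUnbounded R)
    (x : ℝ) (hx : 0 < x) :
    (∃! τ : ℝ, IsTau R x τ) ∧
    ∀ τ : ℝ, IsTau R x τ → ∀ y : ℝ, τ < y →
      (∀ θ : Step, IsLeast (kernelRoots R θ x y) (rho R x y)) ∧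
      (∀ θ : Step, 0 < verticalDrift R θ x y) ∧
      ∀ θ : Step,
        GFConverges (classC R θ) (rho R x y) x y ∧
        GFConverges (classD R θ) (rho R x y) x y ∧
        GFConverges (classHstar R) (rho R x y) x 0 ∧
        0 < cPlus R θ x y ∧
        HasDominantSimplePole (fun m => partitionFn (classH R θ) m x y)
          (rho R x y) (cPlus R θ x y) ∧
        (fun m : ℕ => partitionFn (classH R θ) m x y)
          ~[atTop] fun m : ℕ => cPlus R θ x y * mu R x y ^ m := by
  refine ⟨existsUnique_isTau hA hV hx, fun τ hτ y hy => ?_⟩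
  have hy0 : 0 < y := hτ.1.trans hy
  have hlt := hτ.rho_lt hA hV hx hy
  refine ⟨isLeast_kernelRoots hA hx hy0, fun θ => ?_, fun θ => ?_⟩
  · exact div_pos (dyB_pos hA hV hx hτ hy θ)
      (mul_pos (rho_pos hA hx hy0) (classH_pole_of_rho_lt hA hx hτ.1 hy hlt θ).1)
  · exact (classH_pole_of_rho_lt hA hx hτ.1 hy hlt θ).2
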